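/- Let $A\in\mathbb C^{n\times n}$ have all its eigenvalues in the open unit disc, let $B\in\mathbb C^{n\times 1}$ be nonzero, and let $(A,B)$ be reachable, i.e. $B,AB,\dots,A^{n-1}B$ span $\mathbb C^n$. Put $G(z)=(zI-A)^{-1}B$ and, on the unit circle $\mathbb T$, let $G^*$ be the conjugate transpose of $G$. All integrals are over $\mathbb T$ with respect to the normalized Lebesgue measure $d\vartheta/2\pi$. Let $\Psi:\mathbb T\to\mathbb R$ be a bounded coercive scalar spectral density, i.e. $\Psi$ is measurable and there are constants $0<a\le b<\infty$ with $a\le\Psi\le b$ almost everywhere. For continuous $\Phi:\mathbb T\to\mathbb R$ put $\Gamma(\Phi)=\int G\Phi G^*$, and let $$P_\Gamma=\{\Sigma\in\operatorname{Range}\Gamma : \Sigma>0\},$$ $$\mathcal L^{KL}_\Gamma=\{\Lambda\in\operatorname{Range}\Gamma : \Lambda=\Lambda^*,\ G^*(e^{i\vartheta})\Lambda G(e^{i\vartheta})>0\text{ for all }\vartheta\}.$$ Then for every $\Sigma\in P_\Gamma$ the functional $$J(\Lambda;\Sigma)=-\int\Psi\log(G^*\Lambda G)+\operatorname{tr}(\Lambda\Sigma)$$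 has exactly one minimum point $\Lambda^{KL}_{opt}(\Sigma)$ on $\mathcal L^{KL}_\Gamma$, and the map $\Sigma\mapsto\Lambda^{KL}_{opt}(\Sigma)$ is continuous from $P_\Gamma$ to $\mathcal L^{KL}_\Gamma$. -/

import Mathlib

open Matrix MeasureTheory
open scoped ComplexOrder

namespace SpectrumKL

noncomputable section

variable {n : ℕ}

/-- The normalized Lebesgue measure `dϑ / 2π` on one period `(0, 2π]`; the unit circle is
parametrized by `ϑ ↦ Circle.exp ϑ = e^{iϑ}`. -/
def angleMeasure : Measure ℝ :=
  ENNReal.ofReal (2 * Real.pi)⁻¹ • volume.restrict (Set.Ioc 0 (2 * Real.pi))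

/-- The integral of a function on the unit circle against normalized Lebesgue measure. -/
def circleIntegralNormalized {E : Type*} [NormedAddCommGroup E] [NormedSpace ℝ E]
    (f : Circle → E) : E :=
  ∫ θ, f (Circle.exp θ) ∂angleMeasure

/-- A discrete-time stability matrix: all eigenvalues lie in the open unit disc. -/
def IsStable (A : Matrix (Fin n) (Fin n) ℂ) : Prop :=
  ∀ μ ∈ spectrum ℂ A, ‖μ‖ < 1

/-- Reachability of `(A, B)` with a single input: `B, AB, …, A^{n-1}B` span `ℂⁿ`. -/
def IsReachable (A : Matrix (Fin n) (Fin n) ℂ) (B : Fin n → ℂ) : Prop :=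
  Submodule.span ℂ (Set.range fun k : Fin n => (A ^ (k : ℕ)) *ᵥ B) = ⊤

/-- The transfer function `G(z) = (zI - A)⁻¹ B`, a column vector. -/
def G (A : Matrix (Fin n) (Fin n) ℂ) (B : Fin n → ℂ) (z : Circle) : Fin n → ℂ :=
  ((z : ℂ) • (1 : Matrix (Fin n) (Fin n) ℂ) - A)⁻¹ *ᵥ B

/-- Bounded and coercive scalar spectral densities on the unit circle. -/
structure IsSpectralDensity (Ψ : Circle → ℝ) : Prop where
  aemeasurable : AEMeasurable (fun θ : ℝ => Ψ (Circle.exp θ)) angleMeasure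
  coercive : ∃ a : ℝ, 0 < a ∧ ∀ᵐ θ ∂angleMeasure, a ≤ Ψ (Circle.exp θ)
  bounded : ∃ b : ℝ, ∀ᵐ θ ∂angleMeasure, Ψ (Circle.exp θ) ≤ b

/-- The operator `Γ(Φ) = ∫ G Φ G^*` on real continuous functions on the circle
(the integral of a matrix is taken entrywise). -/
def Γ (A : Matrix (Fin n) (Fin n) ℂ) (B : Fin n → ℂ) (Φ : C(Circle, ℝ)) :
    Matrix (Fin n) (Fin n) ℂ :=
  Matrix.of fun i j =>
    circleIntegralNormalized fun z => G A B z i * (Φ z : ℂ) * star (G A B z j)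

/-- `P_Γ`: the positive definite elements of `Range Γ`. -/
def PΓ (A : Matrix (Fin n) (Fin n) ℂ) (B : Fin n → ℂ) : Set (Matrix (Fin n) (Fin n) ℂ) :=
  {S | S ∈ Set.range (Γ A B) ∧ S.PosDef}

/-- The scalar `G^* Λ G` at a point of the circle. It is real for Hermitian `Λ`; its real part
is taken to obtain a term of type `ℝ`. -/
def GΛG (A : Matrix (Fin n) (Fin n) ℂ) (B : Fin n → ℂ) (Λ : Matrix (Fin n) (Fin n) ℂ)
    (z : Circle) : ℝ :=
  (star (G A B z) ⬝ᵥ (Λ *ᵥ G A B z)).re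

/-- `L^KL`: Hermitian `Λ` with `G^* Λ G > 0` on the whole circle. -/
def LKL (A : Matrix (Fin n) (Fin n) ℂ) (B : Fin n → ℂ) : Set (Matrix (Fin n) (Fin n) ℂ) :=
  {Λ | Λ.IsHermitian ∧ ∀ z : Circle, 0 < GΛG A B Λ z}

/-- `L^KL_Γ = L^KL ∩ Range Γ`. -/
def LKLΓ (A : Matrix (Fin n) (Fin n) ℂ) (B : Fin n → ℂ) : Set (Matrix (Fin n) (Fin n) ℂ) :=
  LKL A B ∩ Set.range (Γ A B)

/-- The dual functional `J(Λ; S) = -∫ Ψ log (G^* Λ G) + tr (Λ S)`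
(the trace is real for Hermitian `Λ`, `S`). -/
def J (A : Matrix (Fin n) (Fin n) ℂ) (B : Fin n → ℂ) (Ψ : Circle → ℝ)
    (S Λ : Matrix (Fin n) (Fin n) ℂ) : ℝ :=
  -(circleIntegralNormalized fun z => Ψ z * Real.log (GΛG A B Λ z)) + (Λ * S).trace.re

end

end SpectrumKL

/-! `Γ` is adjoint to the quadratic form map: `tr (Λ Γ(Φ)) = ∫ (G^* Λ G) Φ`. If `G^* Λ G = 0` for `Λ
= Γ(Φ)`, this gives `tr (Λ^* Λ) = 0`, so `Λ ↦ G^* Λ G` is injective on `Range Γ`. The problem thus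
moves to a finite-dimensional space `W` of functions on the circle: minimize `-∫ log f dμ + ℓ_S(f)`
over the positive `f` in `W`, where `μ` has density `Ψ`. Strict concavity of the logarithm gives
uniqueness. Existence and continuity follow once, for `S` near any `S₀`, all minimizers lie in one
compact subset of the open cone (`exists_continuous_minimizer`).

Two estimates supply that compact set. Coercivity, `c * ‖f‖ ≤ ℓ_S(f)` uniformly for `S` near `S₀`,
keeps `f` bounded. It comes from Fejér–Riesz and reachability: a positive `G^* Λ G` equals `|c^*
G|²` for some vector `c`, so `tr (Λ S) = c^* S c`, which is bounded below because `S` is positive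
definite (`exists_trace_lower_bound`).

The logarithm alone does not blow up at the boundary of the cone, but its derivative does. The
functions in `W` are twice differentiable in the angle, so near a minimum they grow at most
quadratically and `∫ 1 / f dμ` tends to infinity as `min f` tends to zero
(`hasReciprocalBarrier_densityMeasure`). Adding a small multiple of a fixed positive `u` to such an
`f` therefore does not increase the objective (`exists_forall_improve`). -/

namespace SpectrumKL

/-! ### Fejér–Riesz factorization on the unit circle. -/

open Polynomial ComplexConjugate

/-- The conjugate reflection `z ^ m * conj (p (1 / conj z))` of a polynomial `p` of degree at
most `m`. -/
noncomputable def conjReflect (m : ℕ) (p : ℂ[X]) : ℂ[X] :=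
  reflect m (p.map (starRingEnd ℂ))

theorem natDegree_conjReflect_le {m : ℕ} {p : ℂ[X]} (hp : p.natDegree ≤ m) :
    (conjReflect m p).natDegree ≤ m := by
  refine (natDegree_reflect_le).trans ?_
  rw [natDegree_map]
  exact max_le le_rfl hp

theorem eval_conjReflect {m : ℕ} {p : ℂ[X]} (hp : p.natDegree ≤ m) {z : ℂ} (hz : z ≠ 0) :
    (conjReflect m p).eval z = z ^ m * conj (p.eval (conj z)⁻¹) := by
  have hz' : z⁻¹ ≠ 0 := inv_ne_zero hz
  let _ : Invertible z⁻¹ := invertibleOfNonzero hz'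
  have h := eval₂_reflect_mul_pow (RingHom.id ℂ) z⁻¹ m (p.map (starRingEnd ℂ))
    (by rwa [natDegree_map])
  rw [invOf_eq_inv, inv_inv] at h
  change eval z (conjReflect m p) * _ = eval z⁻¹ _ at h
  have h2 : conj (p.eval (conj z)⁻¹) = eval z⁻¹ (p.map (starRingEnd ℂ)) := by
    rw [eval_map, ← eval₂_at_apply, map_inv₀, Complex.conj_conj]
  rw [h2, ← h, inv_pow]
  field_simp

theorem inv_conj_circle (z : Circle) : (conj (z : ℂ))⁻¹ = z := by
  rw [← Circle.coe_inv_eq_conj, Circle.coe_inv, inv_inv]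

theorem eval_conjReflect_circle {m : ℕ} {p : ℂ[X]} (hp : p.natDegree ≤ m) (z : Circle) :
    (conjReflect m p).eval (z : ℂ) = (z : ℂ) ^ m * conj (p.eval (z : ℂ)) := by
  rw [eval_conjReflect hp z.coe_ne_zero, inv_conj_circle]

theorem polynomial_eq_of_eqOn_circle {p q : ℂ[X]}
    (h : ∀ z : Circle, p.eval (z : ℂ) = q.eval (z : ℂ)) : p = q := by
  refine eq_of_infinite_eval_eq p q (Set.Infinite.mono (s := Set.range ((↑) : Circle → ℂ)) ?_ ?_)
  · rintro _ ⟨z, rfl⟩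
    exact h z
  · have : Infinite Circle := by
      have : Infinite (Set.Ioc (-Real.pi) Real.pi) :=
        Set.infinite_coe_iff.mpr (Set.Ioc_infinite (by linarith [Real.pi_pos]))
      exact Infinite.of_injective (β := Set.Ioc (-Real.pi) Real.pi) Circle.argEquiv.symm
        Circle.argEquiv.symm.injective
    exact Set.infinite_range_of_injective (α := Circle) Circle.coe_injective

theorem conjReflect_eq_self {m : ℕ} {P : ℂ[X]} (hP : P.natDegree ≤ 2 * m)
    (h : ∀ z : Circle, ∃ r : ℝ, 0 < r ∧ P.eval (z : ℂ) = r * (z : ℂ) ^ m) :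
    conjReflect (2 * m) P = P := by
  refine polynomial_eq_of_eqOn_circle fun z => ?_
  obtain ⟨r, -, hr⟩ := h z
  have hz : (z : ℂ) * conj (z : ℂ) = 1 := by
    rw [← Circle.coe_inv_eq_conj, Circle.coe_inv, mul_inv_cancel₀ z.coe_ne_zero]
  rw [eval_conjReflect_circle hP, hr, map_mul, map_pow, Complex.conj_ofReal]
  calc (z : ℂ) ^ (2 * m) * (r * conj (z : ℂ) ^ m)
      = r * (z : ℂ) ^ m * ((z : ℂ) * conj (z : ℂ)) ^ m := by ring
    _ = _ := by rw [hz]; ring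

theorem circle_mul_sub_conj (z : Circle) (a : ℂ) :
    ((z : ℂ) - a) * (1 - conj a * z) = ((‖(z : ℂ) - a‖ ^ 2 : ℝ) : ℂ) * z := by
  have hz : (z : ℂ) * conj (z : ℂ) = 1 := by
    rw [← Circle.coe_inv_eq_conj, Circle.coe_inv, mul_inv_cancel₀ z.coe_ne_zero]
  rw [← Complex.normSq_eq_norm_sq, ← Complex.mul_conj, map_sub]
  linear_combination (-(z : ℂ) + a) * hz

/-- **Fejér–Riesz**: a trigonometric polynomial that is strictly positive on the unit circle is
the squared modulus of a polynomial. -/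
theorem fejer_riesz_of_pos (m : ℕ) (P : ℂ[X]) (hP : P.natDegree ≤ 2 * m)
    (h : ∀ z : Circle, ∃ r : ℝ, 0 < r ∧ P.eval (z : ℂ) = r * (z : ℂ) ^ m) :
    ∃ Q : ℂ[X], Q.natDegree ≤ m ∧
      ∀ z : Circle, P.eval (z : ℂ) = ((‖Q.eval (z : ℂ)‖ ^ 2 : ℝ) : ℂ) * (z : ℂ) ^ m := by
  induction m generalizing P with
  | zero =>
    obtain ⟨c, rfl⟩ := natDegree_eq_zero.mp (Nat.le_zero.mp hP)
    obtain ⟨r, hr, hc⟩ := h 1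
    refine ⟨C ((√r : ℝ) : ℂ), by simp, fun z => ?_⟩
    simp only [eval_C, pow_zero, mul_one] at hc ⊢
    rw [hc, Complex.norm_real, Real.norm_of_nonneg (Real.sqrt_nonneg _), Real.sq_sqrt hr.le]
  | succ m ih =>
    have hself := conjReflect_eq_self hP h
    have hne : ∀ z : Circle, P.eval (z : ℂ) ≠ 0 := by
      intro z
      obtain ⟨r, hr, hz⟩ := h z
      rw [hz]
      exact mul_ne_zero (by exact_mod_cast hr.ne') (pow_ne_zero _ z.coe_ne_zero)
    have hP0 : P ≠ 0 := by
      rintro rfl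
      exact hne 1 (by simp)
    have hcoeff : conj (P.coeff 0) = P.coeff (2 * (m + 1)) := by
      conv_rhs => rw [← hself]
      rw [conjReflect, coeff_reflect, revAt_le le_rfl, coeff_map, Nat.sub_self]
    -- By self-reflection the two extreme coefficients are conjugate, so they vanish together;
    -- dividing by `X` then lowers the degree bound by two.
    by_cases h0 : P.coeff 0 = 0
    · obtain ⟨R, hR⟩ := X_dvd_iff.mpr h0
      have hR0 : R ≠ 0 := by rintro rfl; simp [hP0] at hR
      have hdeg : R.natDegree ≤ 2 * m := by
        have h1 : P.natDegree ≠ 2 * (m + 1) := by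
          intro h1
          rw [h0, map_zero, ← h1] at hcoeff
          exact hP0 (leadingCoeff_eq_zero.mp hcoeff.symm)
        rw [hR, natDegree_X_mul hR0] at h1 hP
        omega
      obtain ⟨Q, hQ, hQz⟩ := ih R hdeg fun z => by
        obtain ⟨r, hr, hz⟩ := h z
        refine ⟨r, hr, mul_left_cancel₀ z.coe_ne_zero ?_⟩
        rw [hR, eval_mul, eval_X] at hz
        rw [hz]; ring
      refine ⟨Q, hQ.trans (Nat.le_succ m), fun z => ?_⟩
      rw [hR, eval_mul, eval_X, hQz z]; ring
    · have hdegP : P.natDegree = 2 * (m + 1) :=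
        le_antisymm hP (le_natDegree_of_ne_zero (by
          rw [← hcoeff]; exact (_root_.map_ne_zero _).mpr h0))
      -- Roots come in pairs `a`, `1 / conj a`, distinct because none lies on the circle. On the
      -- circle the pair contributes `|z - a|² z` up to a constant, which is split off before the
      -- induction hypothesis applies.
      obtain ⟨a, ha⟩ := IsAlgClosed.exists_root P (by
        rw [degree_eq_natDegree hP0, hdegP]; norm_cast)
      have ha0 : a ≠ 0 := by
        rintro rfl
        exact h0 (by rwa [coeff_zero_eq_eval_zero])
      have hca0 : conj a ≠ 0 := (_root_.map_ne_zero _).mpr ha0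
      have hnorm : ‖a‖ ≠ 1 := fun hn => hne ⟨a, mem_sphere_zero_iff_norm.mpr hn⟩ ha
      have hb : P.IsRoot (conj a)⁻¹ := by
        rw [IsRoot.def, ← hself, eval_conjReflect hP (inv_ne_zero hca0)]
        simp [ha.eq_zero]
      have hab : a ≠ (conj a)⁻¹ := by
        intro hab
        have h1 : a * conj a = 1 := by
          nth_rewrite 1 [hab]; exact inv_mul_cancel₀ hca0
        rw [Complex.mul_conj, Complex.normSq_eq_norm_sq] at h1
        have h2 : ‖a‖ ^ 2 = 1 := by exact_mod_cast h1
        exact hnorm ((pow_eq_one_iff_of_nonneg (norm_nonneg a) two_ne_zero).mp h2)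
      obtain ⟨R, hR⟩ := (isCoprime_X_sub_C_of_isUnit_sub
        (sub_ne_zero.mpr hab).isUnit).mul_dvd (dvd_iff_isRoot.mpr ha) (dvd_iff_isRoot.mpr hb)
      have hR0 : R ≠ 0 := by rintro rfl; simp [hP0] at hR
      have hmonic : ((X - C a) * (X - C (conj a)⁻¹)).Monic :=
        (monic_X_sub_C a).mul (monic_X_sub_C _)
      have hdeg : R.natDegree = 2 * m := by
        rw [hR, hmonic.natDegree_mul' hR0, (monic_X_sub_C a).natDegree_mul (monic_X_sub_C _),
          natDegree_X_sub_C, natDegree_X_sub_C] at hdegP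
        omega
      have heval : ∀ z : Circle, P.eval (z : ℂ)
          = ((‖(z : ℂ) - a‖ ^ 2 : ℝ) : ℂ) * z * (C (-(conj a)⁻¹) * R).eval (z : ℂ) := by
        intro z
        rw [hR, ← circle_mul_sub_conj]
        simp only [eval_mul, eval_sub, eval_X, eval_C]
        field_simp
        ring
      obtain ⟨Q, hQ, hQz⟩ := ih (C (-(conj a)⁻¹) * R) (by
          rw [natDegree_C_mul (neg_ne_zero.mpr (inv_ne_zero hca0)), hdeg]) fun z => by
        obtain ⟨r, hr, hz⟩ := h z
        have hza : ‖(z : ℂ) - a‖ ^ 2 ≠ 0 := by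
          rw [Ne, sq_eq_zero_iff, norm_eq_zero, sub_eq_zero]
          rintro rfl
          exact hne z ha
        refine ⟨r / ‖(z : ℂ) - a‖ ^ 2, div_pos hr (by positivity), ?_⟩
        rw [heval z] at hz
        have hzc : ((‖(z : ℂ) - a‖ ^ 2 : ℝ) : ℂ) ≠ 0 := by exact_mod_cast hza
        refine mul_left_cancel₀ (mul_ne_zero hzc z.coe_ne_zero) ?_
        rw [hz, Complex.ofReal_div]
        field_simp
        ring
      refine ⟨(X - C a) * Q, natDegree_mul_le.trans (by rw [natDegree_X_sub_C]; omega),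
        fun z => ?_⟩
      rw [heval z, hQz z, eval_mul, norm_mul, eval_sub, eval_X, eval_C]
      push_cast
      ring

open Filter Topology

/-! ### Integrals of logarithms of positive continuous functions. -/

section LogIntegral

variable {X : Type*} [TopologicalSpace X] [CompactSpace X] [MeasurableSpace X] [BorelSpace X]
  (ν : Measure X) [IsFiniteMeasure ν]

theorem integrable_of_continuous {f : X → ℝ} (hf : Continuous f) : Integrable f ν :=
  hf.integrable_of_hasCompactSupport (HasCompactSupport.of_compactSpace f)

theorem exists_pos_le_of_pos {X : Type*} [TopologicalSpace X] [CompactSpace X] [Nonempty X] {f : X → ℝ} (hf : Continuous f) (h : ∀ x, 0 < f x) :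
    ∃ m, 0 < m ∧ ∀ x, m ≤ f x := by
  obtain ⟨x, -, hx⟩ := isCompact_univ.exists_isMinOn Set.univ_nonempty hf.continuousOn
  exact ⟨f x, h x, fun y => hx (Set.mem_univ y)⟩

theorem integral_log_le_tangent {f g : X → ℝ} (hf : Continuous f) (hg : Continuous g)
    (hf0 : ∀ x, 0 < f x) (hg0 : ∀ x, 0 < g x) :
    ∫ x, Real.log (f x) ∂ν ≤ ∫ x, Real.log (g x) ∂ν + ∫ x, (f x - g x) / g x ∂ν := by
  have h1 := integrable_of_continuous ν (hf.log fun x => (hf0 x).ne')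
  have h2 := integrable_of_continuous ν (hg.log fun x => (hg0 x).ne')
  have h3 : Integrable (fun x => (f x - g x) / g x) ν :=
    integrable_of_continuous ν ((hf.sub hg).div hg fun x => (hg0 x).ne')
  rw [← integral_add h2 h3]
  refine integral_mono h1 (h2.add h3) fun x => ?_
  have h4 := Real.log_le_sub_one_of_pos (div_pos (hf0 x) (hg0 x))
  rw [Real.log_div (hf0 x).ne' (hg0 x).ne'] at h4
  have h5 : (f x - g x) / g x = f x / g x - 1 := by
    rw [sub_div, div_self (hg0 x).ne']
  change Real.log (f x) ≤ Real.log (g x) + (f x - g x) / g x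
  rw [h5]
  linarith

theorem integral_log_le_norm (f : C(X, ℝ)) (hf0 : ∀ x, 0 < f x) :
    ∫ x, Real.log (f x) ∂ν ≤ ν.real Set.univ * Real.log ‖f‖ := by
  have h1 := integrable_of_continuous ν (f.continuous.log fun x => (hf0 x).ne')
  calc ∫ x, Real.log (f x) ∂ν ≤ ∫ _, Real.log ‖f‖ ∂ν :=
        integral_mono h1 (integrable_const _) fun x =>
          Real.log_le_log (hf0 x) ((le_abs_self _).trans (f.norm_coe_le_norm x))
    _ = _ := by simp

theorem continuousAt_integral_log [Nonempty X] (f : C(X, ℝ)) (hf0 : ∀ x, 0 < f x) :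
    ContinuousAt (fun g : C(X, ℝ) => ∫ x, Real.log (g x) ∂ν) f := by
  obtain ⟨m, hm, hmf⟩ := exists_pos_le_of_pos f.continuous hf0
  have hev : ∀ᶠ g in 𝓝 f, ∀ x, m / 2 ≤ g x ∧ g x ≤ ‖f‖ + m / 2 := by
    filter_upwards [Metric.ball_mem_nhds f (half_pos hm)] with g hg x
    have h1 : |g x - f x| ≤ m / 2 := by
      rw [← Real.dist_eq]
      exact (ContinuousMap.dist_apply_le_dist x).trans (Metric.mem_ball.mp hg).le
    have h2 := abs_le.mp h1
    have h3 := (le_abs_self _).trans (f.norm_coe_le_norm x)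
    have h4 := hmf x
    constructor <;> linarith
  refine continuousAt_of_dominated
    (bound := fun _ => |Real.log (m / 2)| + |Real.log (‖f‖ + m / 2)|) ?_ ?_
    (integrable_const _) ?_
  · filter_upwards [hev] with g hg
    exact (integrable_of_continuous ν (g.continuous.log fun x =>
      (lt_of_lt_of_le (half_pos hm) (hg x).1).ne')).aestronglyMeasurable
  · filter_upwards [hev] with g hg
    refine Eventually.of_forall fun x => ?_
    have h1 := Real.log_le_log (half_pos hm) (hg x).1
    have h2 := Real.log_le_log (lt_of_lt_of_le (half_pos hm) (hg x).1) (hg x).2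
    rw [Real.norm_eq_abs, abs_le]
    have h3 := neg_abs_le (Real.log (m / 2))
    have h4 := le_abs_self (Real.log (‖f‖ + m / 2))
    have h5 := abs_nonneg (Real.log (m / 2))
    have h6 := abs_nonneg (Real.log (‖f‖ + m / 2))
    constructor <;> linarith
  · exact Eventually.of_forall fun x =>
      ContinuousAt.log (continuous_eval_const x).continuousAt (hf0 x).ne'

theorem integral_log_midpoint_lt [ν.IsOpenPosMeasure] {f g : X → ℝ} (hf : Continuous f)
    (hg : Continuous g) (hf0 : ∀ x, 0 < f x) (hg0 : ∀ x, 0 < g x) (hfg : f ≠ g) :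
    (∫ x, Real.log (f x) ∂ν + ∫ x, Real.log (g x) ∂ν) / 2
      < ∫ x, Real.log ((f x + g x) / 2) ∂ν := by
  have hs0 : ∀ x, 0 < (f x + g x) / 2 := fun x => half_pos (add_pos (hf0 x) (hg0 x))
  have c1 := hf.log fun x => (hf0 x).ne'
  have c2 := hg.log fun x => (hg0 x).ne'
  have c3 : Continuous fun x => Real.log ((f x + g x) / 2) :=
    ((hf.add hg).div_const 2).log fun x => (hs0 x).ne'
  have i1 := integrable_of_continuous ν c1
  have i2 := integrable_of_continuous ν c2
  have i3 := integrable_of_continuous ν c3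
  have hlt : ∀ x, f x ≠ g x →
      (Real.log (f x) + Real.log (g x)) / 2 < Real.log ((f x + g x) / 2) := by
    intro x hx
    have h := strictConcaveOn_log_Ioi.2 (Set.mem_Ioi.mpr (hf0 x)) (Set.mem_Ioi.mpr (hg0 x)) hx (show (0 : ℝ) < 1 / 2 by norm_num)
      (show (0 : ℝ) < 1 / 2 by norm_num) (by norm_num)
    simp only [smul_eq_mul] at h
    rw [show (f x + g x) / 2 = 1 / 2 * f x + 1 / 2 * g x by ring]
    linarith
  obtain ⟨x₀, hx₀⟩ := Function.ne_iff.mp hfg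
  have hpos : 0 < ∫ x, (Real.log ((f x + g x) / 2)
      - (Real.log (f x) + Real.log (g x)) / 2) ∂ν := by
    refine Continuous.integral_pos_of_hasCompactSupport_nonneg_nonzero (x := x₀)
      (c3.sub ((c1.add c2).div_const 2)) (HasCompactSupport.of_compactSpace _) ?_
      (sub_pos.mpr (hlt x₀ hx₀)).ne'
    intro x
    by_cases hx : f x = g x
    · simp [hx]
    · exact (sub_pos.mpr (hlt x hx)).le
  have i4 : Integrable (fun x => (Real.log (f x) + Real.log (g x)) / 2) ν :=
    (i1.add i2).div_const 2
  rw [integral_sub i3 i4, integral_div, integral_add i1 i2] at hpos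
  linarith

end LogIntegral

/-! ### Minimizing `-∫ log f + ℓ f` on the positive cone, with parameters. -/

section Minimization

variable {X : Type*} [TopologicalSpace X] [CompactSpace X] [MeasurableSpace X] [BorelSpace X]
  (ν : Measure X)

/-- The elements of a space of continuous functions that are positive everywhere. -/
def positiveCone (W : Submodule ℝ C(X, ℝ)) : Set W := {f | ∀ x, 0 < (f : C(X, ℝ)) x}

/-- The integrals `∫ 1 / f` blow up as the minimum of `f` tends to zero, uniformly on bounded
subsets of the positive cone. -/
def HasReciprocalBarrier (W : Submodule ℝ C(X, ℝ)) : Prop :=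
  ∀ R T : ℝ, ∃ δ : ℝ, 0 < δ ∧ ∀ f ∈ positiveCone W, ‖f‖ ≤ R →
    (∃ x, (f : C(X, ℝ)) x < δ) → T ≤ ∫ x, ((f : C(X, ℝ)) x)⁻¹ ∂ν

/-- The functional `-∫ log f + ℓ f`. -/
noncomputable def logObjective {W : Submodule ℝ C(X, ℝ)} (ℓ : W →ₗ[ℝ] ℝ) (f : W) : ℝ :=
  -(∫ x, Real.log ((f : C(X, ℝ)) x) ∂ν) + ℓ f

variable [IsFiniteMeasure ν] {W : Submodule ℝ C(X, ℝ)}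

theorem logObjective_unique [ν.IsOpenPosMeasure] {ℓ : W →ₗ[ℝ] ℝ} {f g : W}
    (hf : f ∈ positiveCone W) (hg : g ∈ positiveCone W)
    (hfmin : IsMinOn (logObjective ν ℓ) (positiveCone W) f)
    (hgmin : IsMinOn (logObjective ν ℓ) (positiveCone W) g) : f = g := by
  by_contra hfg
  have hne : ((f : C(X, ℝ)) : X → ℝ) ≠ ((g : C(X, ℝ)) : X → ℝ) := fun h =>
    hfg (Subtype.ext (DFunLike.coe_injective h))
  have h := integral_log_midpoint_lt ν (f : C(X, ℝ)).continuous (g : C(X, ℝ)).continuous hf hg hne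
  have hval : ∀ x, (((2 : ℝ)⁻¹ • (f + g) : W) : C(X, ℝ)) x
      = ((f : C(X, ℝ)) x + (g : C(X, ℝ)) x) / 2 := fun x => by
    simp [div_eq_inv_mul, mul_add]
  have hmem : (2 : ℝ)⁻¹ • (f + g) ∈ positiveCone W := fun x => by
    rw [hval]
    exact half_pos (add_pos (hf x) (hg x))
  have h1 : logObjective ν ℓ f ≤ logObjective ν ℓ ((2 : ℝ)⁻¹ • (f + g)) := hfmin hmem
  have h2 : logObjective ν ℓ g ≤ logObjective ν ℓ ((2 : ℝ)⁻¹ • (f + g)) := hgmin hmem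
  simp only [logObjective, hval, map_smul, map_add, smul_eq_mul] at h1 h2
  linarith

/-- The competitor `g` is `u` if `u` is already better, `f` if `f` stays away from zero, and `f + t
• u` otherwise. The bounds `R`, `δ` depend on `ℓ` only through `c` and `L`, which makes them locally
uniform in the parameter. -/
theorem exists_forall_improve [Nonempty X] {u : W} (hu : u ∈ positiveCone W)
    (hν : HasReciprocalBarrier ν W) (hν0 : 0 < ν.real Set.univ) {c L : ℝ} (hc : 0 < c) :
    ∃ R δ : ℝ, 0 < δ ∧ ∀ ℓ : W →ₗ[ℝ] ℝ, (∀ f ∈ positiveCone W, c * ‖f‖ ≤ ℓ f) → ℓ u ≤ L →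
      ∀ f ∈ positiveCone W, ∃ g : W, ‖g‖ ≤ R ∧ (∀ x, δ ≤ (g : C(X, ℝ)) x) ∧
        logObjective ν ℓ g ≤ logObjective ν ℓ f := by
  obtain ⟨m, hm, hmu⟩ := exists_pos_le_of_pos (u : C(X, ℝ)).continuous hu
  set N := ν.real Set.univ
  set T₀ := -(∫ x, Real.log ((u : C(X, ℝ)) x) ∂ν) + L
  set R₀ := 2 / c * (T₀ + N * Real.log (2 * N / c))
  obtain ⟨δ₀, hδ₀, hbar⟩ := hν (R₀ + ‖u‖) (L / m)
  have hupos : 0 < ‖u‖ := by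
    obtain ⟨x⟩ := ‹Nonempty X›
    exact lt_of_lt_of_le (hu x) ((le_abs_self _).trans ((u : C(X, ℝ)).norm_coe_le_norm x))
  -- Small enough that `f + t • u` still dips below `δ₀` when `f` dips below `δ₀ / 2`, and
  -- independent of `f`, so that `t * m` is a uniform lower bound.
  set t := min 1 (δ₀ / (2 * ‖u‖))
  have ht0 : 0 < t := lt_min one_pos (by positivity)
  have htu : t * ‖u‖ ≤ δ₀ / 2 := by
    calc t * ‖u‖ ≤ δ₀ / (2 * ‖u‖) * ‖u‖ := by gcongr; exact min_le_right _ _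
      _ = δ₀ / 2 := by field_simp
  refine ⟨max ‖u‖ (R₀ + ‖u‖), min m (min (δ₀ / 2) (t * m)),
    lt_min hm (lt_min (half_pos hδ₀) (mul_pos ht0 hm)), fun ℓ hℓ hℓu f hf => ?_⟩
  rcases lt_or_ge (logObjective ν ℓ u) (logObjective ν ℓ f) with hlt | hle
  · exact ⟨u, le_max_left _ _, fun x => (min_le_left _ _).trans (hmu x), hlt.le⟩
  have hfpos : 0 < ‖f‖ := by
    obtain ⟨x⟩ := ‹Nonempty X›
    exact lt_of_lt_of_le (hf x) ((le_abs_self _).trans ((f : C(X, ℝ)).norm_coe_le_norm x))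
  have hfR : ‖f‖ ≤ R₀ := by
    have h1 : logObjective ν ℓ f ≤ T₀ := hle.trans (by simp only [logObjective, T₀]; linarith)
    have h2 : ∫ x, Real.log ((f : C(X, ℝ)) x) ∂ν ≤ N * Real.log ‖f‖ :=
      integral_log_le_norm ν (f : C(X, ℝ)) hf
    -- Linearizing the logarithm at `2 * N / c` makes `N * log ‖f‖` consume only half of the
    -- coercive term `c * ‖f‖`.
    have h3 := Real.log_le_sub_one_of_pos (show 0 < ‖f‖ / (2 * N / c) by positivity)
    rw [Real.log_div hfpos.ne' (by positivity)] at h3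
    have h4 : N * (Real.log ‖f‖ - Real.log (2 * N / c)) ≤ c / 2 * ‖f‖ := by
      calc N * (Real.log ‖f‖ - Real.log (2 * N / c)) ≤ N * (‖f‖ / (2 * N / c)) := by
            gcongr; linarith
        _ = c / 2 * ‖f‖ := by field_simp
    have h5 := hℓ f hf
    simp only [logObjective] at h1
    have h6 : c / 2 * ‖f‖ ≤ T₀ + N * Real.log (2 * N / c) := by linarith
    calc ‖f‖ = 2 / c * (c / 2 * ‖f‖) := by field_simp
      _ ≤ R₀ := mul_le_mul_of_nonneg_left h6 (by positivity)
  by_cases hmin : ∃ x, (f : C(X, ℝ)) x < δ₀ / 2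
  swap
  · push Not at hmin
    refine ⟨f, hfR.trans (le_max_of_le_right (by linarith)), fun x => ?_, le_rfl⟩
    exact (min_le_right _ _).trans ((min_le_left _ _).trans (hmin x))
  obtain ⟨x₀, hx₀⟩ := hmin
  have hval : ∀ x, ((f + t • u : W) : C(X, ℝ)) x
      = (f : C(X, ℝ)) x + t * (u : C(X, ℝ)) x := fun x => by simp
  have hg : f + t • u ∈ positiveCone W := fun x => by
    rw [hval]; exact add_pos (hf x) (mul_pos ht0 (hu x))
  have hgR : ‖f + t • u‖ ≤ R₀ + ‖u‖ := by
    have h1 : ‖t • u‖ ≤ ‖u‖ := by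
      calc ‖t • u‖ = ‖t‖ * ‖u‖ := norm_smul t (u : C(X, ℝ))
        _ ≤ ‖u‖ := by
          rw [Real.norm_of_nonneg ht0.le]
          exact mul_le_of_le_one_left hupos.le (min_le_left _ _)
    exact (norm_add_le f (t • u)).trans (add_le_add hfR h1)
  refine ⟨f + t • u, hgR.trans (le_max_right _ _), fun x => ?_, ?_⟩
  · rw [hval]
    refine (min_le_right _ _).trans ((min_le_right _ _).trans ?_)
    have := mul_le_mul_of_nonneg_left (hmu x) ht0.le
    linarith [hf x]
  have hT := hbar _ hg hgR ⟨x₀, by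
    rw [hval]
    have h1 : t * (u : C(X, ℝ)) x₀ ≤ t * ‖u‖ := by
      gcongr; exact (le_abs_self _).trans ((u : C(X, ℝ)).norm_coe_le_norm x₀)
    linarith⟩
  -- The tangent is taken at `f + t • u`: the logarithmic integral gains at least `t * m * ∫ 1 / (f
  -- + t • u) ≥ t * L`, which pays for the linear cost `t * ℓ u ≤ t * L`.
  have htan := integral_log_le_tangent ν (f : C(X, ℝ)).continuous
    ((f + t • u : W) : C(X, ℝ)).continuous hf hg
  have hginv : Continuous fun x => (((f + t • u : W) : C(X, ℝ)) x)⁻¹ :=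
    ((f + t • u : W) : C(X, ℝ)).continuous.inv₀ fun x => (hg x).ne'
  have hint : ∫ x, ((f : C(X, ℝ)) x - ((f + t • u : W) : C(X, ℝ)) x)
      / ((f + t • u : W) : C(X, ℝ)) x ∂ν ≤ -(t * m) * (L / m) := by
    calc _ ≤ ∫ x, -(t * m) * (((f + t • u : W) : C(X, ℝ)) x)⁻¹ ∂ν := by
          refine integral_mono (integrable_of_continuous ν
            (((f : C(X, ℝ)).continuous.sub ((f + t • u : W) : C(X, ℝ)).continuous).div
              ((f + t • u : W) : C(X, ℝ)).continuous fun x => (hg x).ne'))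
            (integrable_of_continuous ν (continuous_const.mul hginv)) fun x => ?_
          change _ / _ ≤ _
          rw [div_eq_mul_inv]
          refine mul_le_mul_of_nonneg_right ?_ (inv_nonneg.mpr (hg x).le)
          rw [hval]
          have := mul_le_mul_of_nonneg_left (hmu x) ht0.le
          linarith
      _ = -(t * m) * ∫ x, (((f + t • u : W) : C(X, ℝ)) x)⁻¹ ∂ν := integral_const_mul _ _
      _ ≤ -(t * m) * (L / m) := mul_le_mul_of_nonpos_left hT (by
          have := mul_pos ht0 hm; linarith)
  have hLm : -(t * m) * (L / m) = -(t * L) := by field_simp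
  have htL : t * ℓ u ≤ t * L := by gcongr
  simp only [logObjective, map_add, map_smul, smul_eq_mul]
  linarith

/-- Near `s₀` all minimizers lie in one compact `K` inside the cone. By joint continuity of the
objective any cluster point of them minimizes at `s₀`, so by uniqueness it is `opt s₀`; compactness
turns this into convergence. -/
theorem exists_continuous_minimizer [Nonempty X] [ν.IsOpenPosMeasure] [FiniteDimensional ℝ W]
    {P : Type*} [TopologicalSpace P] (ℓ : P → W →ₗ[ℝ] ℝ)
    (hℓ : Continuous fun p : P × W => ℓ p.1 p.2) (hν : HasReciprocalBarrier ν W)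
    {u : W} (hu : u ∈ positiveCone W)
    (hcoer : ∀ s₀, ∃ c : ℝ, 0 < c ∧ ∀ᶠ s in 𝓝 s₀, ∀ f ∈ positiveCone W, c * ‖f‖ ≤ ℓ s f) :
    ∃ opt : P → W, Continuous opt ∧ ∀ s, opt s ∈ positiveCone W ∧
      ∀ f ∈ positiveCone W, IsMinOn (logObjective ν (ℓ s)) (positiveCone W) f ↔ f = opt s := by
  have hν0 : 0 < ν.real Set.univ := by
    rw [measureReal_def, ENNReal.toReal_pos_iff]
    exact ⟨isOpen_univ.measure_pos ν Set.univ_nonempty, measure_lt_top ν _⟩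
  have hcont : ∀ f ∈ positiveCone W, ∀ s, ContinuousAt
      (fun p : P × W => logObjective ν (ℓ p.1) p.2) (s, f) := by
    intro f hf s
    refine ContinuousAt.add (ContinuousAt.neg ?_) hℓ.continuousAt
    exact ContinuousAt.comp (f := fun p : P × W => (p.2 : C(X, ℝ))) (x := (s, f))
      (continuousAt_integral_log ν (f : C(X, ℝ)) hf)
      (continuous_subtype_val.comp continuous_snd).continuousAt
  have key : ∀ s₀, ∃ K : Set W, IsCompact K ∧ K ⊆ positiveCone W ∧ ∀ᶠ s in 𝓝 s₀,
      ∀ f ∈ positiveCone W, ∃ g ∈ K, logObjective ν (ℓ s) g ≤ logObjective ν (ℓ s) f := by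
    intro s₀
    obtain ⟨c, hc, hcs⟩ := hcoer s₀
    obtain ⟨R, δ, hδ, h⟩ := exists_forall_improve ν hu hν hν0 (L := ℓ s₀ u + 1) hc
    refine ⟨Metric.closedBall 0 R ∩ {g | ∀ x, δ ≤ (g : C(X, ℝ)) x}, ?_, ?_, ?_⟩
    · have : ProperSpace W := FiniteDimensional.proper ℝ W
      refine (isCompact_closedBall (0 : W) R).inter_right ?_
      simp only [Set.ofPred_forall]
      exact isClosed_iInter fun x => isClosed_le continuous_const
        ((continuous_eval_const x).comp continuous_subtype_val)
    · exact fun g hg x => hδ.trans_le (hg.2 x)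
    · have hu' : ∀ᶠ s in 𝓝 s₀, ℓ s u < ℓ s₀ u + 1 := by
        have : Continuous fun s => ℓ s u := hℓ.comp (continuous_id.prodMk continuous_const)
        exact this.continuousAt.eventually_lt_const (by linarith)
      filter_upwards [hcs, hu'] with s hs hsu f hf
      obtain ⟨g, hgR, hgδ, hgf⟩ := h (ℓ s) hs hsu.le f hf
      exact ⟨g, ⟨mem_closedBall_zero_iff.mpr hgR, hgδ⟩, hgf⟩
  have hex : ∀ s, ∃ f ∈ positiveCone W, IsMinOn (logObjective ν (ℓ s)) (positiveCone W) f := by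
    intro s
    obtain ⟨K, hK, hKpos, hs⟩ := key s
    have hs' := hs.self_of_nhds
    obtain ⟨g₀, hg₀, -⟩ := hs' u hu
    obtain ⟨f, hf, hfmin⟩ := hK.exists_isMinOn ⟨g₀, hg₀⟩ (f := logObjective ν (ℓ s))
      fun f hf => ((hcont f (hKpos hf) s).comp (f := fun f : W => (s, f))
        (Continuous.prodMk_right s).continuousAt).continuousWithinAt
    refine ⟨f, hKpos hf, fun h hh => ?_⟩
    obtain ⟨g, hg, hgh⟩ := hs' h hh
    exact (hfmin hg).trans hgh
  choose opt hopt hmin using hex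
  refine ⟨opt, ?_, fun s => ⟨hopt s, fun f hf =>
    ⟨fun h => logObjective_unique ν hf (hopt s) h (hmin s), fun h => h ▸ hmin s⟩⟩⟩
  refine continuous_iff_continuousAt.mpr fun s₀ => ?_
  obtain ⟨K, hK, hKpos, hs⟩ := key s₀
  refine hK.tendsto_nhds_of_unique_mapClusterPt (l := 𝓝 s₀) ?_ ?_
  · filter_upwards [hs] with s hs
    obtain ⟨g, hg, hle⟩ := hs (opt s) (hopt s)
    have : g = opt s := logObjective_unique ν (hKpos hg) (hopt s)
      (fun h hh => hle.trans (hmin s hh)) (hmin s)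
    exact this ▸ hg
  · intro f hf hcl
    refine logObjective_unique (ℓ := ℓ s₀) ν (hKpos hf) (hopt s₀) (fun h hh => ?_) (hmin s₀)
    show logObjective ν (ℓ s₀) f ≤ logObjective ν (ℓ s₀) h
    refine le_of_forall_pos_le_add fun ε hε => ?_
    have e1 := (hcont f (hKpos hf) s₀).eventually_const_lt
      (show logObjective ν (ℓ s₀) f - ε / 2 < logObjective ν (ℓ s₀) f by linarith)
    rw [nhds_prod_eq, eventually_prod_iff] at e1
    obtain ⟨p, hp, q, hq, hpq⟩ := e1
    have e2 : ∀ᶠ s in 𝓝 s₀, logObjective ν (ℓ s) h < logObjective ν (ℓ s₀) h + ε / 2 :=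
      ((hcont h hh s₀).comp (f := fun s : P => (s, h))
        (Continuous.prodMk_left h).continuousAt).eventually_lt_const
        (show logObjective ν (ℓ s₀) h < logObjective ν (ℓ s₀) h + ε / 2 by linarith)
    obtain ⟨s, h1, h2, h3⟩ := ((hcl.frequently hq).and_eventually (hp.and e2)).exists
    have h1 := hpq h2 h1
    have h4 : logObjective ν (ℓ s) (opt s) ≤ logObjective ν (ℓ s) h := hmin s hh
    simp only at h1
    linarith

end Minimization

/-! ### The transfer function as a quotient of polynomials; reachability. -/

section TransferFunction

variable {n : ℕ}

theorem natDegree_adjugate_charmatrix_le (A : Matrix (Fin n) (Fin n) ℂ) (i j : Fin n) :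
    (A.charmatrix.adjugate i j).natDegree ≤ n - 1 := by
  cases n with
  | zero => exact i.elim0
  | succ m =>
    rw [adjugate_fin_succ_eq_det_submatrix]
    have h : A.charmatrix.submatrix j.succAbove i.succAbove
        = (X : ℂ[X]) • ((1 : Matrix (Fin (m + 1)) (Fin (m + 1)) ℂ).submatrix
            j.succAbove i.succAbove).map C + ((-A).submatrix j.succAbove i.succAbove).map C := by
      ext1 k l
      simp [charmatrix_apply, Matrix.one_apply, Matrix.diagonal_apply, apply_ite C,
        sub_eq_add_neg]
    rw [h]
    refine (natDegree_mul_le).trans ?_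
    have h1 : ((-1 : ℂ[X]) ^ (j + i : ℕ)).natDegree = 0 := by
      rw [← Int.cast_negOnePow_natCast, natDegree_intCast]
    rw [h1, zero_add]
    exact (natDegree_det_X_add_C_le _ _).trans (by simp)

/-- The polynomial vector `adj (zI - A) B`, the numerator of the transfer function. -/
noncomputable def numerator (A : Matrix (Fin n) (Fin n) ℂ) (B : Fin n → ℂ) : Fin n → ℂ[X] :=
  A.charmatrix.adjugate *ᵥ fun i => C (B i)

theorem natDegree_numerator_le (A : Matrix (Fin n) (Fin n) ℂ) (B : Fin n → ℂ) (i : Fin n) :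
    (numerator A B i).natDegree ≤ n - 1 :=
  natDegree_sum_le_of_forall_le Finset.univ (fun j => A.charmatrix.adjugate i j * C (B j))
    fun j _ => (natDegree_mul_C_le _ _).trans (natDegree_adjugate_charmatrix_le A i j)

theorem eval_charpoly_ne_zero {A : Matrix (Fin n) (Fin n) ℂ} (hA : IsStable A) (z : Circle) :
    A.charpoly.eval (z : ℂ) ≠ 0 := fun h => by
  have := hA z (Matrix.mem_spectrum_iff_isRoot_charpoly.mpr h)
  rw [Circle.norm_coe] at this
  exact lt_irrefl _ this

theorem G_eq_div (A : Matrix (Fin n) (Fin n) ℂ) (B : Fin n → ℂ)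
    (z : Circle) (i : Fin n) :
    G A B z i = (numerator A B i).eval (z : ℂ) / A.charpoly.eval (z : ℂ) := by
  have hmap : (evalRingHom (z : ℂ)).mapMatrix A.charmatrix
      = (z : ℂ) • (1 : Matrix (Fin n) (Fin n) ℂ) - A := by
    ext k l
    simp [charmatrix_apply, Matrix.one_apply, Matrix.diagonal_apply, apply_ite (eval (z : ℂ))]
  have hdet : ((z : ℂ) • (1 : Matrix (Fin n) (Fin n) ℂ) - A).det = A.charpoly.eval (z : ℂ) := by
    rw [← hmap, ← RingHom.map_det]; rfl
  have hadj : ((z : ℂ) • (1 : Matrix (Fin n) (Fin n) ℂ) - A).adjugate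
      = (evalRingHom (z : ℂ)).mapMatrix A.charmatrix.adjugate := by
    rw [← hmap, RingHom.map_adjugate]
  rw [G, Matrix.inv_def, Ring.inverse_eq_inv', hdet, hadj, smul_mulVec, Pi.smul_apply,
    smul_eq_mul, div_eq_inv_mul]
  congr 1
  simp [numerator, mulVec, dotProduct, eval_finsetSum]

/-- Write `A v = z v - (zI - A) v` and use `adj (zI - A) (zI - A) = χ(z) I`. -/
theorem numerator_mulVec (A : Matrix (Fin n) (Fin n) ℂ) (v : Fin n → ℂ) (i : Fin n) :
    numerator A (A *ᵥ v) i = X * numerator A v i - A.charpoly * C (v i) := by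
  have h1 : (fun i => C ((A *ᵥ v) i))
      = (X : ℂ[X]) • (fun i => C (v i)) - A.charmatrix *ᵥ fun i => C (v i) := by
    ext1 k
    simp [charmatrix, Matrix.sub_mulVec, mulVec, dotProduct, map_sum]
  rw [numerator, h1, Matrix.mulVec_sub, Matrix.mulVec_smul, Matrix.mulVec_mulVec, adjugate_mul,
    smul_mulVec, one_mulVec]
  simp [numerator, charpoly]

theorem natDegree_sum_C_mul_numerator_le (A : Matrix (Fin n) (Fin n) ℂ) (c v : Fin n → ℂ) :
    (∑ i, C (c i) * numerator A v i).natDegree ≤ n - 1 :=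
  natDegree_sum_le_of_forall_le _ _ fun i _ =>
    (natDegree_C_mul_le _ _).trans (natDegree_numerator_le A v i)

/-- If the combination vanishes for `v`, then for `A v` it equals `-χ (c ⬝ᵥ v)`. Its degree is below
`n = deg χ`, so `c ⬝ᵥ v = 0` and it vanishes for `A v` too. Iterating from `B`, `c` annihilates
every `A ^ k B`, and these span. -/
theorem eq_zero_of_sum_C_mul_numerator_eq_zero {A : Matrix (Fin n) (Fin n) ℂ} {B : Fin n → ℂ}
    (hAB : IsReachable A B) {c : Fin n → ℂ} (hc : ∑ i, C (c i) * numerator A B i = 0) :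
    c = 0 := by
  rcases Nat.eq_zero_or_pos n with rfl | hn
  · exact Subsingleton.elim _ _
  have hstep : ∀ v : Fin n → ℂ, ∑ i, C (c i) * numerator A v i = 0 →
      ∑ i, C (c i) * numerator A (A *ᵥ v) i = 0 ∧ c ⬝ᵥ v = 0 := by
    intro v hv
    have h1 : ∑ i, C (c i) * numerator A (A *ᵥ v) i = -(A.charpoly * C (c ⬝ᵥ v)) := by
      have : ∀ i, C (c i) * numerator A (A *ᵥ v) i
          = X * (C (c i) * numerator A v i) - A.charpoly * C (c i * v i) := fun i => by
        rw [numerator_mulVec, C_mul]; ring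
      simp_rw [this]
      rw [Finset.sum_sub_distrib, ← Finset.mul_sum, hv, ← Finset.mul_sum, dotProduct, map_sum]
      ring
    have h2 : c ⬝ᵥ v = 0 := by
      by_contra h
      have h3 := natDegree_sum_C_mul_numerator_le A c (A *ᵥ v)
      rw [h1, natDegree_neg, natDegree_mul_C h, charpoly_natDegree_eq_dim, Fintype.card_fin] at h3
      omega
    exact ⟨by rw [h1, h2]; simp, h2⟩
  have hpow : ∀ k : ℕ, ∑ i, C (c i) * numerator A ((A ^ k) *ᵥ B) i = 0 := by
    intro k
    induction k with
    | zero => simpa using hc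
    | succ k ih =>
      rw [pow_succ', ← mulVec_mulVec]
      exact (hstep _ ih).1
  have hker : (⊤ : Submodule ℂ (Fin n → ℂ)) ≤ LinearMap.ker (dotProductBilin ℂ ℂ c) := by
    rw [← hAB, Submodule.span_le]
    rintro _ ⟨k, rfl⟩
    exact (hstep _ (hpow k)).2
  ext i
  have := hker (Submodule.mem_top (x := Pi.single i 1))
  simpa using this

/-- An injective linear map from `ℂⁿ` to the `n`-dimensional space of polynomials of degree below
`n` is onto. -/
theorem exists_sum_C_mul_numerator_eq {A : Matrix (Fin n) (Fin n) ℂ} {B : Fin n → ℂ}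
    (hn : 0 < n) (hAB : IsReachable A B) {Q : ℂ[X]} (hQ : Q.natDegree ≤ n - 1) :
    ∃ c : Fin n → ℂ, ∑ i, C (c i) * numerator A B i = Q := by
  have hmem : ∀ c : Fin n → ℂ, ∑ i, c i • numerator A B i ∈ degreeLT ℂ n := fun c => by
    have h := natDegree_sum_C_mul_numerator_le A c B
    simp_rw [← smul_eq_C_mul] at h
    exact mem_degreeLT.mpr (degree_le_natDegree.trans_lt (by norm_cast; omega))
  let T : (Fin n → ℂ) →ₗ[ℂ] degreeLT ℂ n :=
    (Fintype.linearCombination ℂ (numerator A B)).codRestrict _ fun c => by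
      rw [Fintype.linearCombination_apply]; exact hmem c
  have hT : ∀ c, (T c : ℂ[X]) = ∑ i, C (c i) * numerator A B i := fun c => by
    simp [T, Fintype.linearCombination_apply, smul_eq_C_mul]
  have hinj : Function.Injective T := by
    rw [← LinearMap.ker_eq_bot, LinearMap.ker_eq_bot']
    intro c hc
    refine eq_zero_of_sum_C_mul_numerator_eq_zero hAB (A := A) (B := B) ?_
    rw [← hT, hc]; rfl
  have hfin : Module.finrank ℂ (Fin n → ℂ) = Module.finrank ℂ (degreeLT ℂ n) :=
    (degreeLTEquiv ℂ n).finrank_eq.symm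
  have : FiniteDimensional ℂ (degreeLT ℂ n) := Module.Finite.equiv (degreeLTEquiv ℂ n).symm
  obtain ⟨c, hc⟩ := (LinearMap.injective_iff_surjective_of_finrank_eq_finrank hfin).mp hinj
    ⟨Q, mem_degreeLT.mpr (degree_le_natDegree.trans_lt (by norm_cast; omega))⟩
  exact ⟨c, by rw [← hT, hc]⟩

theorem GΛG_vecMulVec (A : Matrix (Fin n) (Fin n) ℂ) (B c : Fin n → ℂ) (z : Circle) :
    GΛG A B (vecMulVec c (star c)) z = ‖star c ⬝ᵥ G A B z‖ ^ 2 := by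
  rw [GΛG, vecMulVec_mulVec, dotProduct_smul, ← Complex.normSq_eq_norm_sq,
    ← Complex.ofReal_re (Complex.normSq _), ← Complex.mul_conj]
  congr 1
  have : star (G A B z) ⬝ᵥ c = conj (star c ⬝ᵥ G A B z) := by
    change _ = star _
    rw [← star_dotProduct_star, star_star]
  rw [this]
  exact mul_comm _ _

/-- Multiplying by `|χ|² z ^ (n - 1)` clears denominators and conjugates; Fejér–Riesz gives `|Q|²`,
and reachability writes `Q / χ` as a combination of the entries of `G`. The rank-one matrix need not
lie in `Range Γ`. -/
theorem exists_GΛG_eq_vecMulVec {A : Matrix (Fin n) (Fin n) ℂ} {B : Fin n → ℂ}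
    (hA : IsStable A) (hn : 0 < n) (hAB : IsReachable A B) {Λ : Matrix (Fin n) (Fin n) ℂ}
    (hΛ : Λ ∈ LKL A B) :
    ∃ c : Fin n → ℂ, ∀ z, GΛG A B Λ z = GΛG A B (vecMulVec c (star c)) z := by
  have hreal : ∀ z, star (G A B z) ⬝ᵥ (Λ *ᵥ G A B z) = (GΛG A B Λ z : ℂ) := by
    intro z
    refine (Complex.conj_eq_iff_re.mp ?_).symm
    change star _ = _
    rw [← star_dotProduct_star, star_star, star_mulVec, hΛ.1.eq, ← dotProduct_mulVec]
  let P : ℂ[X] := ∑ i, ∑ j, conjReflect (n - 1) (numerator A B i) * (C (Λ i j) * numerator A B j)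
  have hPdeg : P.natDegree ≤ 2 * (n - 1) :=
    natDegree_sum_le_of_forall_le _ _ fun i _ => natDegree_sum_le_of_forall_le _ _ fun j _ => by
      refine natDegree_mul_le.trans ?_
      have h1 := natDegree_conjReflect_le (natDegree_numerator_le A B i)
      have h2 := (natDegree_C_mul_le (Λ i j) _).trans (natDegree_numerator_le A B j)
      omega
  have hP : ∀ z : Circle, P.eval (z : ℂ)
      = ((‖A.charpoly.eval (z : ℂ)‖ ^ 2 * GΛG A B Λ z : ℝ) : ℂ) * (z : ℂ) ^ (n - 1) := by
    intro z
    have hd := eval_charpoly_ne_zero hA z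
    have hp : ∀ i, (numerator A B i).eval (z : ℂ) = A.charpoly.eval (z : ℂ) * G A B z i :=
      fun i => by rw [G_eq_div]; field_simp
    rw [Complex.ofReal_mul, ← hreal, ← Complex.normSq_eq_norm_sq, ← Complex.mul_conj]
    simp only [P, eval_finsetSum, eval_mul, eval_C,
      eval_conjReflect_circle (natDegree_numerator_le A B _), hp, map_mul, mulVec, dotProduct,
      Finset.mul_sum, Finset.sum_mul, Pi.star_apply]
    refine Finset.sum_congr rfl fun i _ => Finset.sum_congr rfl fun j _ => ?_
    change _ = _ * (conj (G A B z i) * _) * _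
    ring
  obtain ⟨Q, hQ, hQz⟩ := fejer_riesz_of_pos (n - 1) P hPdeg fun z =>
    ⟨_, mul_pos (by have := norm_pos_iff.mpr (eval_charpoly_ne_zero hA z); positivity) (hΛ.2 z),
      hP z⟩
  obtain ⟨c, hc⟩ := exists_sum_C_mul_numerator_eq hn hAB hQ
  refine ⟨star c, fun z => ?_⟩
  have hd : ‖A.charpoly.eval (z : ℂ)‖ ≠ 0 := norm_ne_zero_iff.mpr (eval_charpoly_ne_zero hA z)
  have h1 : Q.eval (z : ℂ) = A.charpoly.eval (z : ℂ) * (c ⬝ᵥ G A B z) := by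
    rw [← hc]
    simp only [eval_finsetSum, eval_mul, eval_C, dotProduct, Finset.mul_sum, G_eq_div]
    refine Finset.sum_congr rfl fun i _ => ?_
    have := eval_charpoly_ne_zero hA z
    field_simp
  have h2 := mul_right_cancel₀ (pow_ne_zero _ z.coe_ne_zero) ((hP z).symm.trans (hQz z))
  have h3 : ‖A.charpoly.eval (z : ℂ)‖ ^ 2 * GΛG A B Λ z = ‖Q.eval (z : ℂ)‖ ^ 2 := by
    exact_mod_cast h2
  rw [h1, norm_mul, mul_pow] at h3
  rw [GΛG_vecMulVec, star_star]
  exact mul_left_cancel₀ (pow_ne_zero 2 hd) h3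

end TransferFunction

/-! ### The measure with density `Ψ`, on the angle and on the circle. -/

section Measures

instance : IsFiniteMeasure angleMeasure := by
  unfold angleMeasure
  exact Measure.smul_finite _ ENNReal.ofReal_ne_top

theorem angleMeasure_apply_of_subset {I : Set ℝ} (hI : MeasurableSet I)
    (h : I ⊆ Set.Ioc 0 (2 * Real.pi)) :
    angleMeasure I = ENNReal.ofReal (2 * Real.pi)⁻¹ * volume I := by
  rw [angleMeasure, Measure.smul_apply, smul_eq_mul, Measure.restrict_apply hI,
    Set.inter_eq_left.mpr h]

theorem exists_angle (z : Circle) : ∃ θ ∈ Set.Ioc 0 (2 * Real.pi), Circle.exp θ = z := by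
  obtain ⟨θ, hθ, h⟩ := Circle.periodic_exp.exists_mem_Ioc Real.two_pi_pos (Complex.arg z) 0
  rw [zero_add] at hθ
  exact ⟨θ, hθ, by rw [← h, Circle.exp_arg]⟩

theorem exists_norm_le_of_continuous_circle {E : Type*} [SeminormedAddCommGroup E]
    {f : Circle → E} (hf : Continuous f) : ∃ C, ∀ z, ‖f z‖ ≤ C := by
  obtain ⟨C, hC⟩ := isCompact_univ.exists_bound_of_continuousOn hf.continuousOn
  exact ⟨C, fun z => hC z (Set.mem_univ z)⟩

theorem integrable_comp_exp {f : Circle → ℂ} (hf : Continuous f) :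
    Integrable (fun θ : ℝ => f (Circle.exp θ)) angleMeasure := by
  obtain ⟨C, hC⟩ := exists_norm_le_of_continuous_circle hf
  exact Integrable.of_bound (hf.comp Circle.exp.continuous).aestronglyMeasurable C
    (Filter.Eventually.of_forall fun θ => hC _)

noncomputable instance : MeasurableSpace Circle := borel Circle

instance : BorelSpace Circle := ⟨rfl⟩

/-- The measure with density `Ψ` on the unit circle, as a measure of the angle. -/
noncomputable def angleDensityMeasure (Ψ : Circle → ℝ) : Measure ℝ :=
  angleMeasure.withDensity fun θ => ENNReal.ofReal (Ψ (Circle.exp θ))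

/-- The measure with density `Ψ` on the unit circle. -/
noncomputable def densityMeasure (Ψ : Circle → ℝ) : Measure Circle :=
  (angleDensityMeasure Ψ).map Circle.exp

variable {Ψ : Circle → ℝ}

theorem isFiniteMeasure_angleDensityMeasure (hΨ : IsSpectralDensity Ψ) :
    IsFiniteMeasure (angleDensityMeasure Ψ) := by
  obtain ⟨b, hb⟩ := hΨ.bounded
  refine isFiniteMeasure_withDensity (ne_top_of_le_ne_top ?_
    (lintegral_mono_ae (hb.mono fun θ h => ENNReal.ofReal_le_ofReal h)))
  rw [lintegral_const]
  exact ENNReal.mul_ne_top ENNReal.ofReal_ne_top (measure_ne_top _ _)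

theorem isFiniteMeasure_densityMeasure (hΨ : IsSpectralDensity Ψ) :
    IsFiniteMeasure (densityMeasure Ψ) := by
  have := isFiniteMeasure_angleDensityMeasure hΨ
  exact Measure.isFiniteMeasure_map _ _

theorem integral_densityMeasure {f : Circle → ℝ} (hf : Continuous f) :
    ∫ z, f z ∂densityMeasure Ψ = ∫ θ, f (Circle.exp θ) ∂angleDensityMeasure Ψ :=
  integral_map Circle.exp.continuous.aemeasurable hf.aestronglyMeasurable

theorem circleIntegralNormalized_mul (hΨ : IsSpectralDensity Ψ) {f : Circle → ℝ}
    (hf : Continuous f) :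
    circleIntegralNormalized (fun z => Ψ z * f z) = ∫ z, f z ∂densityMeasure Ψ := by
  obtain ⟨a, ha, hΨa⟩ := hΨ.coercive
  rw [integral_densityMeasure hf, angleDensityMeasure, circleIntegralNormalized,
    integral_withDensity_eq_integral_toReal_smul₀ hΨ.aemeasurable.ennreal_ofReal
      (Filter.Eventually.of_forall fun _ => ENNReal.ofReal_lt_top)]
  refine integral_congr_ae (hΨa.mono fun θ h => ?_)
  simp only [smul_eq_mul]
  rw [ENNReal.toReal_ofReal (ha.le.trans h)]

theorem isOpenPosMeasure_densityMeasure (hΨ : IsSpectralDensity Ψ) :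
    (densityMeasure Ψ).IsOpenPosMeasure := by
  obtain ⟨a, ha, hΨa⟩ := hΨ.coercive
  refine ⟨fun U hU ⟨z, hz⟩ h0 => ?_⟩
  rw [densityMeasure, Measure.map_apply Circle.exp.continuous.measurable hU.measurableSet] at h0
  have hac : angleMeasure ≪ angleDensityMeasure Ψ :=
    withDensity_absolutelyContinuous' hΨ.aemeasurable.ennreal_ofReal
      (hΨa.mono fun θ h => (ENNReal.ofReal_pos.mpr (ha.trans_le h)).ne')
  have h1 := hac h0
  obtain ⟨θ, hθ, rfl⟩ := exists_angle z
  have hopen : IsOpen (Circle.exp ⁻¹' U) := hU.preimage Circle.exp.continuous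
  -- The angle may be the endpoint `2π`; passing to the closure of the open interval still yields a
  -- nonempty open set of angles inside the period.
  have hcl : θ ∈ closure (Set.Ioo 0 (2 * Real.pi)) := by
    rw [closure_Ioo Real.two_pi_pos.ne]
    exact Set.Ioc_subset_Icc_self hθ
  have hne : (Circle.exp ⁻¹' U ∩ Set.Ioo 0 (2 * Real.pi)).Nonempty :=
    mem_closure_iff.mp hcl _ hopen hz
  have h2 := measure_mono_null (μ := angleMeasure)
    (Set.inter_subset_left (t := Set.Ioo 0 (2 * Real.pi))) h1
  have hopen' := hopen.inter (isOpen_Ioo (a := (0 : ℝ)) (b := 2 * Real.pi))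
  rw [angleMeasure_apply_of_subset hopen'.measurableSet
    (Set.inter_subset_right.trans Set.Ioo_subset_Ioc_self), mul_eq_zero] at h2
  rcases h2 with h2 | h2
  · exact (ENNReal.ofReal_pos.mpr (inv_pos.mpr Real.two_pi_pos)).ne' h2
  · exact (hopen'.measure_pos volume hne).ne' h2

theorem isSpectralDensity_one : IsSpectralDensity fun _ => 1 where
  aemeasurable := aemeasurable_const
  coercive := ⟨1, one_pos, Filter.Eventually.of_forall fun _ => le_rfl⟩
  bounded := ⟨1, Filter.Eventually.of_forall fun _ => le_rfl⟩

theorem circleIntegralNormalized_pos {f : Circle → ℝ} (hf : Continuous f) (h0 : ∀ z, 0 ≤ f z)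
    {z₀ : Circle} (hz₀ : f z₀ ≠ 0) : 0 < circleIntegralNormalized f := by
  have := isFiniteMeasure_densityMeasure isSpectralDensity_one
  have := isOpenPosMeasure_densityMeasure isSpectralDensity_one
  have h := circleIntegralNormalized_mul isSpectralDensity_one hf
  simp only [one_mul] at h
  rw [h]
  exact hf.integral_pos_of_hasCompactSupport_nonneg_nonzero
    (HasCompactSupport.of_compactSpace _) h0 hz₀

theorem angleDensityMeasure_real_ge (hΨ : IsSpectralDensity Ψ) {a : ℝ} (ha : 0 < a)
    (hΨa : ∀ᵐ θ ∂angleMeasure, a ≤ Ψ (Circle.exp θ)) {x y : ℝ} (hx : 0 ≤ x)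
    (hy : y ≤ 2 * Real.pi) :
    a * ((2 * Real.pi)⁻¹ * (y - x)) ≤ (angleDensityMeasure Ψ).real (Set.Ioc x y) := by
  have := isFiniteMeasure_angleDensityMeasure hΨ
  have hpi := Real.two_pi_pos
  have h : ENNReal.ofReal (a * ((2 * Real.pi)⁻¹ * (y - x)))
      ≤ angleDensityMeasure Ψ (Set.Ioc x y) := by
    rw [angleDensityMeasure, withDensity_apply _ measurableSet_Ioc,
      ENNReal.ofReal_mul ha.le, ENNReal.ofReal_mul (inv_nonneg.mpr hpi.le), ← Real.volume_Ioc,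
      ← angleMeasure_apply_of_subset measurableSet_Ioc (Set.Ioc_subset_Ioc hx hy),
      ← setLIntegral_const]
    exact lintegral_mono_ae (ae_restrict_of_ae (hΨa.mono fun θ h => ENNReal.ofReal_le_ofReal h))
  rw [measureReal_def]
  exact (ENNReal.ofReal_le_iff_le_toReal (measure_ne_top _ _)).mp h

end Measures

/-! ### Blow-up of `∫ 1 / f` as the minimum of `f` tends to zero. -/

section Barrier

/-- Two applications of the mean value inequality. At a minimum, `f (θ - h) ≥ f θ` turns the
symmetric difference into a quadratic upper bound for `f (θ + h)`, with no mention of the first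
derivative. -/
theorem exists_second_difference_bound {f : ℝ → ℝ} (hf : ContDiff ℝ 2 f) (x y : ℝ) :
    ∃ M : ℝ, 0 ≤ M ∧ ∀ θ ∈ Set.Icc x y, ∀ h : ℝ, |h| ≤ 1 →
      |f (θ + h) + f (θ - h) - 2 * f θ| ≤ M * h ^ 2 := by
  have hf1 : ContDiff ℝ 1 (deriv f) := (contDiff_succ_iff_deriv.mp hf).2.2
  have hfd : Differentiable ℝ f := hf.differentiable (by norm_num)
  have hfd1 : Differentiable ℝ (deriv f) := hf1.differentiable (by norm_num)
  obtain ⟨M, hM⟩ := (isCompact_Icc (a := x - 1) (b := y + 1)).exists_bound_of_continuousOn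
    (hf1.continuous_deriv le_rfl).continuousOn
  have hM' : ∀ t ∈ Set.Icc (x - 1) (y + 1), ‖deriv (deriv f) t‖ ≤ |M| := fun t ht =>
    (hM t ht).trans (le_abs_self M)
  refine ⟨2 * |M|, by positivity, fun θ hθ h hh => ?_⟩
  have hderiv : ∀ t, HasDerivAt (fun t => f (θ + t) + f (θ - t))
      (deriv f (θ + t) - deriv f (θ - t)) t := by
    intro t
    have h1 := (hfd (θ + t)).hasDerivAt.comp_const_add θ t
    have h2 := (hfd (θ - t)).hasDerivAt.comp_const_sub θ t
    rw [sub_eq_add_neg]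
    exact h1.add h2
  have hbound : ∀ t ∈ Set.Icc (-|h|) |h|,
      ‖deriv f (θ + t) - deriv f (θ - t)‖ ≤ 2 * |M| * |h| := by
    intro t ht
    have h1 := Convex.norm_image_sub_le_of_norm_deriv_le (𝕜 := ℝ) (f := deriv f)
      (fun t _ => hfd1 t) hM' (convex_Icc _ _)
      (x := θ - t) (y := θ + t) (by constructor <;> linarith [ht.1, ht.2, hθ.1, hθ.2])
      (by constructor <;> linarith [ht.1, ht.2, hθ.1, hθ.2])
    refine h1.trans ?_
    have h2 : ‖θ + t - (θ - t)‖ ≤ 2 * |h| := by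
      rw [show θ + t - (θ - t) = 2 * t by ring, Real.norm_eq_abs, abs_mul, abs_two]
      linarith [abs_le.mpr ht]
    nlinarith [abs_nonneg M]
  have h3 := Convex.norm_image_sub_le_of_norm_hasDerivWithin_le (𝕜 := ℝ)
    (fun t _ => (hderiv t).hasDerivWithinAt) hbound (convex_Icc _ _)
    (x := 0) (y := h) ⟨by linarith [abs_nonneg h], abs_nonneg h⟩ ⟨neg_abs_le h, le_abs_self h⟩
  simp only [add_zero, sub_zero, Real.norm_eq_abs] at h3
  calc |f (θ + h) + f (θ - h) - 2 * f θ| = |f (θ + h) + f (θ - h) - (f θ + f θ)| := by ring_nf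
    _ ≤ 2 * |M| * |h| * |h| := h3
    _ = 2 * |M| * h ^ 2 := by rw [mul_assoc, abs_mul_abs_self, sq]

theorem exists_bound_of_finiteDimensional {E : Type*} [NormedAddCommGroup E] [NormedSpace ℝ E]
    [FiniteDimensional ℝ E] (φ : E →ₗ[ℝ] ℝ) : ∃ C : ℝ, 0 ≤ C ∧ ∀ x, |φ x| ≤ C * ‖x‖ :=
  ⟨‖LinearMap.toContinuousLinearMap φ‖, norm_nonneg _,
    (LinearMap.toContinuousLinearMap φ).le_opNorm⟩

theorem exists_uniform_second_difference_bound (W : Submodule ℝ C(Circle, ℝ))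
    [FiniteDimensional ℝ W]
    (hW : ∀ f ∈ W, ContDiff ℝ 2 fun θ : ℝ => f (Circle.exp θ)) (x y : ℝ) :
    ∃ M : ℝ, 0 ≤ M ∧ ∀ f : W, ∀ θ ∈ Set.Icc x y, ∀ h : ℝ, |h| ≤ 1 →
      |(f : C(Circle, ℝ)) (Circle.exp (θ + h)) + (f : C(Circle, ℝ)) (Circle.exp (θ - h))
        - 2 * (f : C(Circle, ℝ)) (Circle.exp θ)| ≤ M * ‖f‖ * h ^ 2 := by
  let b := Module.finBasis ℝ W
  choose M hM0 hM using fun i => exists_second_difference_bound (hW (b i) (b i).2) x y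
  choose C hC0 hC using fun i => exists_bound_of_finiteDimensional (b.coord i)
  refine ⟨∑ i, C i * M i, Finset.sum_nonneg fun i _ => mul_nonneg (hC0 i) (hM0 i),
    fun f θ hθ h hh => ?_⟩
  have hval : ∀ z, (f : C(Circle, ℝ)) z = ∑ i, b.coord i f * (b i : C(Circle, ℝ)) z := by
    intro z
    conv_lhs => rw [← b.sum_repr f]
    rw [AddSubmonoidClass.coe_finsetSum, ContinuousMap.sum_apply]
    rfl
  simp only [hval]
  rw [Finset.mul_sum, ← Finset.sum_add_distrib, ← Finset.sum_sub_distrib, Finset.sum_mul,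
    Finset.sum_mul]
  refine (Finset.abs_sum_le_sum_abs _ _).trans (Finset.sum_le_sum fun i _ => ?_)
  have h1 := hC i f
  calc _ = |b.coord i f| * |(b i : C(Circle, ℝ)) (Circle.exp (θ + h))
        + (b i : C(Circle, ℝ)) (Circle.exp (θ - h))
        - 2 * (b i : C(Circle, ℝ)) (Circle.exp θ)| := by rw [← abs_mul]; congr 1; ring
    _ ≤ (C i * ‖f‖) * (M i * h ^ 2) :=
        mul_le_mul h1 (hM i θ hθ h hh) (abs_nonneg _) ((abs_nonneg _).trans h1)
    _ = _ := by ring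

theorem hasReciprocalBarrier_densityMeasure {Ψ : Circle → ℝ} (hΨ : IsSpectralDensity Ψ)
    (W : Submodule ℝ C(Circle, ℝ)) [FiniteDimensional ℝ W]
    (hW : ∀ f ∈ W, ContDiff ℝ 2 fun θ : ℝ => f (Circle.exp θ)) :
    HasReciprocalBarrier (densityMeasure Ψ) W := by
  intro R T
  obtain ⟨a, ha, hΨa⟩ := hΨ.coercive
  obtain ⟨M, hM0, hM⟩ := exists_uniform_second_difference_bound W hW 0 (2 * Real.pi)
  have hpi : 0 < 2 * Real.pi := Real.two_pi_pos
  set N := 1 + M * |R|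
  have hN : 0 < N := by positivity
  set T' := max T 1
  have hT' : 0 < T' := lt_max_of_lt_right one_pos
  -- If `min f < s ^ 2`, then `f ≤ s ^ 2 * N` within `s` of the minimum, so an interval of length
  -- `s` contributes at least `a / (2π N s) ≥ T'`.
  set s := min 1 (a / (2 * Real.pi * N * T'))
  have hs0 : 0 < s := lt_min one_pos (by positivity)
  have hs1 : s ≤ 1 := min_le_left _ _
  refine ⟨s ^ 2, by positivity, fun f hf hfR ⟨x, hx⟩ => ?_⟩
  obtain ⟨z₀, -, hz₀⟩ := isCompact_univ.exists_isMinOn Set.univ_nonempty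
    (f : C(Circle, ℝ)).continuous.continuousOn
  have hmin : ∀ z, (f : C(Circle, ℝ)) z₀ ≤ (f : C(Circle, ℝ)) z := fun z => hz₀ (Set.mem_univ z)
  obtain ⟨θ₀, hθ₀, rfl⟩ := exists_angle z₀
  have hupper : ∀ θ, |θ - θ₀| ≤ s → (f : C(Circle, ℝ)) (Circle.exp θ) ≤ s ^ 2 * N := by
    intro θ hθ
    have h1 := (abs_le.mp (hM f θ₀ (Set.Ioc_subset_Icc_self hθ₀) (θ - θ₀) (hθ.trans hs1))).2
    rw [add_sub_cancel] at h1
    have h2 := hmin (Circle.exp (θ₀ - (θ - θ₀)))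
    have h3 := hmin x
    have h4 : M * ‖f‖ * (θ - θ₀) ^ 2 ≤ M * |R| * s ^ 2 := by
      rw [← sq_abs (θ - θ₀)]
      have := hfR.trans (le_abs_self R)
      gcongr
    calc (f : C(Circle, ℝ)) (Circle.exp θ) ≤ s ^ 2 + M * |R| * s ^ 2 := by linarith
      _ = s ^ 2 * N := by ring
  -- A one-sided interval, on the side where it fits in the period since `s ≤ 1 < π`.
  obtain ⟨l, r, hl, hlr, hr, hI⟩ : ∃ l r : ℝ, 0 ≤ l ∧ r - l = s ∧ r ≤ 2 * Real.pi ∧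
      ∀ θ ∈ Set.Ioc l r, |θ - θ₀| ≤ s := by
    have hpi3 := Real.pi_gt_three
    rcases le_total θ₀ Real.pi with h | h
    · exact ⟨θ₀, θ₀ + s, hθ₀.1.le, by ring, by linarith, fun θ hθ =>
        abs_le.mpr ⟨by linarith [hθ.1], by linarith [hθ.2]⟩⟩
    · exact ⟨θ₀ - s, θ₀, by linarith, by ring, hθ₀.2, fun θ hθ =>
        abs_le.mpr ⟨by linarith [hθ.1], by linarith [hθ.2]⟩⟩
  have hfin := isFiniteMeasure_angleDensityMeasure hΨ
  have hcinv : Continuous fun z => ((f : C(Circle, ℝ)) z)⁻¹ :=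
    (f : C(Circle, ℝ)).continuous.inv₀ fun z => (hf z).ne'
  obtain ⟨C, hC⟩ := exists_norm_le_of_continuous_circle hcinv
  have hint : Integrable (fun θ : ℝ => ((f : C(Circle, ℝ)) (Circle.exp θ))⁻¹)
      (angleDensityMeasure Ψ) :=
    Integrable.of_bound (hcinv.comp Circle.exp.continuous).aestronglyMeasurable C
      (Filter.Eventually.of_forall fun θ => hC _)
  rw [integral_densityMeasure hcinv]
  have h1 : T' ≤ (s ^ 2 * N)⁻¹ * (a * ((2 * Real.pi)⁻¹ * s)) := by
    have h2 : s * (2 * Real.pi * N * T') ≤ a := by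
      rw [← le_div_iff₀ (by positivity)]; exact min_le_right _ _
    have h3 : (s ^ 2 * N)⁻¹ * (a * ((2 * Real.pi)⁻¹ * s)) = a / (s * (2 * Real.pi * N)) := by
      field_simp
    rw [h3, le_div_iff₀ (by positivity)]
    linarith
  calc T ≤ T' := le_max_left _ _
    _ ≤ (s ^ 2 * N)⁻¹ * (a * ((2 * Real.pi)⁻¹ * s)) := h1
    _ ≤ (s ^ 2 * N)⁻¹ * (angleDensityMeasure Ψ).real (Set.Ioc l r) := by
        have := angleDensityMeasure_real_ge hΨ ha hΨa hl hr
        rw [hlr] at this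
        gcongr
    _ ≤ ∫ θ in Set.Ioc l r, ((f : C(Circle, ℝ)) (Circle.exp θ))⁻¹ ∂angleDensityMeasure Ψ :=
        setIntegral_ge_of_const_le_real measurableSet_Ioc (measure_ne_top _ _)
          (fun θ hθ => inv_anti₀ (hf _) (hupper θ (hI θ hθ))) hint.integrableOn
    _ ≤ ∫ θ, ((f : C(Circle, ℝ)) (Circle.exp θ))⁻¹ ∂angleDensityMeasure Ψ :=
        setIntegral_le_integral hint (Filter.Eventually.of_forall fun θ =>
          inv_nonneg.mpr (hf _).le)

end Barrier

/-! ### The adjoint pair `Γ`, `Λ ↦ G^* Λ G`, and coercivity of the trace. -/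

section Operators

variable {n : ℕ} {A : Matrix (Fin n) (Fin n) ℂ} {B : Fin n → ℂ}

theorem continuous_G (hA : IsStable A) (B : Fin n → ℂ) : Continuous (G A B) := by
  refine continuous_pi fun i => ?_
  simp_rw [G_eq_div]
  exact ((numerator A B i).continuous.comp continuous_subtype_val).div
    (A.charpoly.continuous.comp continuous_subtype_val) fun z => eval_charpoly_ne_zero hA z

theorem contDiff_G_exp (hA : IsStable A) (B : Fin n → ℂ) (i : Fin n) :
    ContDiff ℝ 2 fun θ : ℝ => G A B (Circle.exp θ) i := by
  have hexp : ContDiff ℝ 2 fun θ : ℝ => (Circle.exp θ : ℂ) := by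
    simp_rw [Circle.coe_exp]
    exact (Complex.ofRealCLM.contDiff.mul contDiff_const).cexp
  have hpoly : ∀ p : Polynomial ℂ, ContDiff ℝ 2 fun θ : ℝ => p.eval (Circle.exp θ : ℂ) :=
    fun p => ((p.contDiff_aeval (𝕜 := ℂ) 2).restrict_scalars ℝ).comp hexp
  simp_rw [G_eq_div, div_eq_mul_inv]
  exact (hpoly _).mul ((hpoly _).inv fun θ => eval_charpoly_ne_zero hA _)

theorem GΛG_eq_sum (A : Matrix (Fin n) (Fin n) ℂ) (B : Fin n → ℂ)
    (Λ : Matrix (Fin n) (Fin n) ℂ) (z : Circle) :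
    GΛG A B Λ z = (∑ i, ∑ j, Λ i j * (star (G A B z i) * G A B z j)).re := by
  rw [GΛG]
  simp only [mulVec, dotProduct, Finset.mul_sum, Pi.star_apply]
  congr 1
  exact Finset.sum_congr rfl fun i _ => Finset.sum_congr rfl fun j _ => by ring

theorem continuous_GΛG (hA : IsStable A) (B : Fin n → ℂ) (Λ : Matrix (Fin n) (Fin n) ℂ) :
    Continuous (GΛG A B Λ) := by
  have h : ∀ i, Continuous fun z => G A B z i := fun i =>
    (continuous_apply i).comp (continuous_G hA B)
  rw [show GΛG A B Λ = _ from funext (GΛG_eq_sum A B Λ)]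
  exact Complex.continuous_re.comp (continuous_finsetSum _ fun i _ =>
    continuous_finsetSum _ fun j _ => continuous_const.mul ((h i).star.mul (h j)))

theorem contDiff_GΛG_exp (hA : IsStable A) (B : Fin n → ℂ) (Λ : Matrix (Fin n) (Fin n) ℂ) :
    ContDiff ℝ 2 fun θ : ℝ => GΛG A B Λ (Circle.exp θ) := by
  simp_rw [GΛG_eq_sum]
  refine Complex.reCLM.contDiff.comp (ContDiff.sum fun i _ => ContDiff.sum fun j _ =>
    contDiff_const.mul (ContDiff.mul ?_ (contDiff_G_exp hA B j)))
  exact Complex.conjCLE.contDiff.comp (contDiff_G_exp hA B i)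

/-- The real-linear map `Λ ↦ G^* Λ G` into the continuous functions on the unit circle. -/
noncomputable def quadraticFormMap (hA : IsStable A) (B : Fin n → ℂ) :
    Matrix (Fin n) (Fin n) ℂ →ₗ[ℝ] C(Circle, ℝ) where
  toFun Λ := ⟨GΛG A B Λ, continuous_GΛG hA B Λ⟩
  map_add' Λ Λ' := by
    ext z
    simp [GΛG, add_mulVec, dotProduct_add]
  map_smul' r Λ := by
    ext z
    simp [GΛG, smul_mulVec, dotProduct_smul]

theorem integrable_Γ_entry (hA : IsStable A) (B : Fin n → ℂ) (Φ : C(Circle, ℝ)) (i j : Fin n) :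
    Integrable (fun θ : ℝ => G A B (Circle.exp θ) i * (Φ (Circle.exp θ) : ℂ)
      * star (G A B (Circle.exp θ) j)) angleMeasure := by
  have h : ∀ i, Continuous fun z => G A B z i := fun i =>
    (continuous_apply i).comp (continuous_G hA B)
  exact integrable_comp_exp (f := fun z => G A B z i * (Φ z : ℂ) * star (G A B z j))
    (((h i).mul (Complex.continuous_ofReal.comp Φ.continuous)).mul (h j).star)

/-- The operator `Γ` as a real-linear map. -/
noncomputable def ΓLinear (hA : IsStable A) (B : Fin n → ℂ) :
    C(Circle, ℝ) →ₗ[ℝ] Matrix (Fin n) (Fin n) ℂ where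
  toFun := Γ A B
  map_add' Φ Φ' := by
    ext i j
    simp only [Γ, circleIntegralNormalized, of_apply, Matrix.add_apply]
    rw [← integral_add (integrable_Γ_entry hA B Φ i j) (integrable_Γ_entry hA B Φ' i j)]
    refine integral_congr_ae (Filter.Eventually.of_forall fun θ => ?_)
    simp only [ContinuousMap.add_apply, Complex.ofReal_add]
    ring
  map_smul' r Φ := by
    ext i j
    simp only [Γ, circleIntegralNormalized, of_apply, Matrix.smul_apply, RingHom.id_apply]
    rw [← integral_smul]
    refine integral_congr_ae (Filter.Eventually.of_forall fun θ => ?_)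
    simp only [ContinuousMap.smul_apply, smul_eq_mul, Complex.ofReal_mul, Complex.real_smul]
    ring

theorem isHermitian_Γ (A : Matrix (Fin n) (Fin n) ℂ) (B : Fin n → ℂ) (Φ : C(Circle, ℝ)) :
    (Γ A B Φ).IsHermitian := by
  ext i j
  simp only [Γ, circleIntegralNormalized, of_apply, conjTranspose_apply]
  change (starRingEnd ℂ) _ = _
  rw [← integral_conj]
  refine integral_congr_ae (Filter.Eventually.of_forall fun θ => ?_)
  simp only [map_mul, Complex.conj_ofReal, RCLike.star_def, Complex.conj_conj]
  ring

theorem re_trace_mul_Γ (hA : IsStable A) (B : Fin n → ℂ) (Λ : Matrix (Fin n) (Fin n) ℂ)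
    (Φ : C(Circle, ℝ)) :
    (Λ * Γ A B Φ).trace.re = circleIntegralNormalized fun z => GΛG A B Λ z * Φ z := by
  have hint : ∀ i j, Integrable (fun θ : ℝ => Λ i j * (G A B (Circle.exp θ) j
      * (Φ (Circle.exp θ) : ℂ) * star (G A B (Circle.exp θ) i))) angleMeasure := fun i j =>
    (integrable_Γ_entry hA B Φ j i).const_mul _
  have h1 : (Λ * Γ A B Φ).trace = ∫ θ, ∑ i, ∑ j, Λ i j * (G A B (Circle.exp θ) j
      * (Φ (Circle.exp θ) : ℂ) * star (G A B (Circle.exp θ) i)) ∂angleMeasure := by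
    rw [integral_finsetSum _ fun i _ => integrable_finsetSum _ fun j _ => hint i j]
    simp only [trace, diag, mul_apply]
    refine Finset.sum_congr rfl fun i _ => ?_
    rw [integral_finsetSum _ fun j _ => hint i j]
    refine Finset.sum_congr rfl fun j _ => ?_
    rw [integral_const_mul]
    rfl
  rw [h1]
  change Complex.reCLM _ = _
  rw [← ContinuousLinearMap.integral_comp_comm _
    (integrable_finsetSum _ fun i _ => integrable_finsetSum _ fun j _ => hint i j),
    circleIntegralNormalized]
  refine integral_congr_ae (Filter.Eventually.of_forall fun θ => ?_)
  simp only [GΛG_eq_sum, Complex.reCLM_apply]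
  rw [← Complex.re_mul_ofReal]
  congr 1
  simp only [Finset.sum_mul]
  exact Finset.sum_congr rfl fun i _ => Finset.sum_congr rfl fun j _ => by ring

theorem re_trace_vecMulVec_mul (c : Fin n → ℂ) (S : Matrix (Fin n) (Fin n) ℂ) :
    (vecMulVec c (star c) * S).trace.re = (star c ⬝ᵥ (S *ᵥ c)).re := by
  rw [vecMulVec_mul, trace_vecMulVec, dotProduct_comm, ← dotProduct_mulVec]

theorem GΛG_eq_re_trace (Λ : Matrix (Fin n) (Fin n) ℂ) (z : Circle) :
    GΛG A B Λ z = (vecMulVec (G A B z) (star (G A B z)) * Λ).trace.re := by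
  rw [re_trace_vecMulVec_mul, GΛG]

theorem G_ne_zero (hA : IsStable A) (hB : B ≠ 0) (z : Circle) : G A B z ≠ 0 := by
  intro h
  have hdet : IsUnit ((z : ℂ) • (1 : Matrix (Fin n) (Fin n) ℂ) - A).det := by
    have := eval_charpoly_ne_zero hA z
    rw [Matrix.eval_charpoly] at this
    rw [smul_one_eq_diagonal]
    exact this.isUnit
  refine hB ?_
  rw [← one_mulVec B, ← mul_nonsing_inv _ hdet, ← mulVec_mulVec]
  change _ *ᵥ G A B z = 0
  rw [h, mulVec_zero]

/-- By adjointness the value is `∫ |G(z)^* G(w)|² dw`, whose integrand is nonzero at `w = z`. This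
provides the interior point `u` of the cone. -/
theorem GΛG_Γ_one_pos (hA : IsStable A) (hB : B ≠ 0) (z : Circle) :
    0 < GΛG A B (Γ A B 1) z := by
  rw [GΛG_eq_re_trace, re_trace_mul_Γ hA]
  simp only [ContinuousMap.one_apply, mul_one]
  refine circleIntegralNormalized_pos (continuous_GΛG hA B _) (fun w => ?_) (z₀ := z) ?_
  · rw [GΛG_vecMulVec]
    positivity
  · rw [GΛG_vecMulVec]
    exact pow_ne_zero _ (norm_ne_zero_iff.mpr (dotProduct_star_self_eq_zero.not.mpr
      (G_ne_zero hA hB z)))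

theorem eq_zero_of_GΛG_Γ_eq_zero (hA : IsStable A) {Φ : C(Circle, ℝ)}
    (h : ∀ z, GΛG A B (Γ A B Φ) z = 0) : Γ A B Φ = 0 := by
  have h1 := re_trace_mul_Γ hA B (Γ A B Φ) Φ
  simp only [h, zero_mul, circleIntegralNormalized, integral_zero] at h1
  have h2 : ((Γ A B Φ)ᴴ * Γ A B Φ).trace = 0 := by
    have h3 : 0 ≤ ((Γ A B Φ)ᴴ * Γ A B Φ).trace :=
      (posSemidef_conjTranspose_mul_self _).trace_nonneg
    refine Complex.ext ?_ (Complex.nonneg_iff.mp h3).2.symm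
    rwa [isHermitian_Γ]
  exact trace_conjTranspose_mul_self_eq_zero_iff.mp h2

theorem exists_quadratic_lower_bound {S₀ : Matrix (Fin n) (Fin n) ℂ} (hS₀ : S₀.PosDef) :
    ∃ l : ℝ, 0 < l ∧ ∀ᶠ S in 𝓝 S₀, ∀ c : Fin n → ℂ, l * ‖c‖ ^ 2 ≤ (star c ⬝ᵥ (S *ᵥ c)).re := by
  have hcont : Continuous fun p : Matrix (Fin n) (Fin n) ℂ × (Fin n → ℂ) =>
      (star p.2 ⬝ᵥ (p.1 *ᵥ p.2)).re :=
    Complex.continuous_re.comp (continuous_snd.star.dotProduct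
      (continuous_fst.matrix_mulVec continuous_snd))
  have hpos : ∀ c ∈ Metric.sphere (0 : Fin n → ℂ) 1, 0 < (star c ⬝ᵥ (S₀ *ᵥ c)).re := by
    intro c hc
    exact hS₀.re_dotProduct_pos (ne_zero_of_mem_unit_sphere ⟨c, hc⟩)
  obtain ⟨l, hl, hlS⟩ : ∃ l : ℝ, 0 < l ∧ ∀ c ∈ Metric.sphere (0 : Fin n → ℂ) 1,
      l < (star c ⬝ᵥ (S₀ *ᵥ c)).re := by
    rcases (Metric.sphere (0 : Fin n → ℂ) 1).eq_empty_or_nonempty with he | hne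
    · exact ⟨1, one_pos, by simp [he]⟩
    · obtain ⟨c, hc, hmin⟩ := (isCompact_sphere (0 : Fin n → ℂ) 1).exists_isMinOn hne
        (hcont.comp (Continuous.prodMk_right S₀)).continuousOn
      refine ⟨_, half_pos (hpos c hc), fun c' hc' => (half_lt_self (hpos c hc)).trans_le ?_⟩
      exact hmin hc'
  refine ⟨l, hl, ?_⟩
  have hev : ∀ᶠ S in 𝓝 S₀, ∀ c ∈ Metric.sphere (0 : Fin n → ℂ) 1,
      l < (star c ⬝ᵥ (S *ᵥ c)).re :=
    (isCompact_sphere (0 : Fin n → ℂ) 1).eventually_forall_of_forall_eventually fun c hc =>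
      hcont.continuousAt.eventually_const_lt (hlS c hc)
  filter_upwards [hev] with S hS c
  rcases eq_or_ne c 0 with rfl | hc
  · simp
  have hc' : ‖c‖ ≠ 0 := norm_ne_zero_iff.mpr hc
  have h1 := hS ((‖c‖⁻¹ : ℝ) • c) (by
    rw [mem_sphere_zero_iff_norm, norm_smul, norm_inv, norm_norm, inv_mul_cancel₀ hc'])
  rw [star_smul, mulVec_smul, smul_dotProduct, dotProduct_smul, star_trivial, smul_smul,
    Complex.real_smul, Complex.re_ofReal_mul] at h1
  have h2 : 0 < ‖c‖ ^ 2 := by positivity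
  have h3 := mul_lt_mul_of_pos_left h1 h2
  have h4 : ‖c‖ ^ 2 * (‖c‖⁻¹ * ‖c‖⁻¹ * (star c ⬝ᵥ (S *ᵥ c)).re)
      = (star c ⬝ᵥ (S *ᵥ c)).re := by field_simp
  rw [h4] at h3
  linarith

theorem exists_GΛG_vecMulVec_le (hA : IsStable A) (B : Fin n → ℂ) :
    ∃ M : ℝ, 0 < M ∧ ∀ (c : Fin n → ℂ) (z : Circle),
      GΛG A B (vecMulVec c (star c)) z ≤ M * ‖c‖ ^ 2 := by
  obtain ⟨C, hC⟩ := exists_norm_le_of_continuous_circle (continuous_G hA B)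
  refine ⟨(n * |C|) ^ 2 + 1, by positivity, fun c z => ?_⟩
  rw [GΛG_vecMulVec]
  have h1 : ‖star c ⬝ᵥ G A B z‖ ≤ n * |C| * ‖c‖ := by
    calc ‖star c ⬝ᵥ G A B z‖ ≤ ∑ i, ‖star c i * G A B z i‖ := norm_sum_le _ _
      _ ≤ ∑ _i : Fin n, ‖c‖ * |C| := by
          refine Finset.sum_le_sum fun i _ => ?_
          rw [norm_mul, Pi.star_apply, norm_star]
          exact mul_le_mul (norm_le_pi_norm c i) ((norm_le_pi_norm _ i).trans
            ((hC z).trans (le_abs_self C))) (norm_nonneg _) (norm_nonneg _)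
      _ = n * |C| * ‖c‖ := by simp; ring
  calc ‖star c ⬝ᵥ G A B z‖ ^ 2 ≤ (n * |C| * ‖c‖) ^ 2 := by gcongr
    _ ≤ ((n * |C|) ^ 2 + 1) * ‖c‖ ^ 2 := by rw [mul_pow]; gcongr; linarith

/-- A local lower bound for `tr (Λ S)` on the cone of multipliers, uniform in `S`. -/
theorem exists_trace_lower_bound (hA : IsStable A) (hn : 0 < n) (hAB : IsReachable A B)
    {S₀ : Matrix (Fin n) (Fin n) ℂ} (hS₀ : S₀.PosDef) :
    ∃ c : ℝ, 0 < c ∧ ∀ᶠ S in 𝓝 S₀, S ∈ Set.range (Γ A B) → ∀ Λ ∈ LKL A B, ∀ z,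
      c * GΛG A B Λ z ≤ (Λ * S).trace.re := by
  obtain ⟨l, hl, hlS⟩ := exists_quadratic_lower_bound hS₀
  obtain ⟨M, hM, hMc⟩ := exists_GΛG_vecMulVec_le hA B
  refine ⟨l / M, div_pos hl hM, ?_⟩
  filter_upwards [hlS]
  rintro S hS ⟨Φ, rfl⟩ Λ hΛ z
  obtain ⟨c, hc⟩ := exists_GΛG_eq_vecMulVec hA hn hAB hΛ
  have h1 : (Λ * Γ A B Φ).trace.re = (star c ⬝ᵥ (Γ A B Φ *ᵥ c)).re := by
    -- Since `S = Γ(Φ)`, the trace depends on `Λ` only through `G^* Λ G`, so `Λ` may be replaced by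
    -- the rank-one matrix.
    rw [← re_trace_vecMulVec_mul, re_trace_mul_Γ hA, re_trace_mul_Γ hA]
    simp_rw [hc]
  rw [h1, hc]
  refine le_trans ?_ (hS c)
  calc l / M * GΛG A B (vecMulVec c (star c)) z ≤ l / M * (M * ‖c‖ ^ 2) := by
        gcongr; exact hMc c z
    _ = l * ‖c‖ ^ 2 := by field_simp

end Operators

end SpectrumKL

/-! ### Transfer from `Range Γ` to the function space and conclusion. -/

theorem mainTheorem2 {n : ℕ} (A : Matrix (Fin n) (Fin n) ℂ) (B : Fin n → ℂ)
    (hA : SpectrumKL.IsStable A) (hB : B ≠ 0) (hAB : SpectrumKL.IsReachable A B)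
    (Ψ : Circle → ℝ) (hΨ : SpectrumKL.IsSpectralDensity Ψ) :
    ∃ Λopt : SpectrumKL.PΓ A B → SpectrumKL.LKLΓ A B,
      (∀ (S : SpectrumKL.PΓ A B), ∀ Λ ∈ SpectrumKL.LKLΓ A B,
        IsMinOn (SpectrumKL.J A B Ψ S) (SpectrumKL.LKLΓ A B) Λ ↔ Λ = Λopt S) ∧
      Continuous Λopt := by
  open SpectrumKL Topology in
  have hn : 0 < n := Nat.pos_of_ne_zero fun h => hB (by subst h; exact Subsingleton.elim _ _)
  have hfin := isFiniteMeasure_densityMeasure hΨ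
  have hopen := isOpenPosMeasure_densityMeasure hΨ
  set V : Submodule ℝ (Matrix (Fin n) (Fin n) ℂ) := LinearMap.range (ΓLinear hA B)
  let q : V →ₗ[ℝ] C(Circle, ℝ) := (quadraticFormMap hA B).domRestrict V
  have hq : Function.Injective q := by
    rw [← LinearMap.ker_eq_bot, LinearMap.ker_eq_bot']
    rintro ⟨_, Φ, rfl⟩ h
    exact Subtype.ext (eq_zero_of_GΛG_Γ_eq_zero hA fun z => DFunLike.congr_fun h z)
  set W : Submodule ℝ C(Circle, ℝ) := LinearMap.range q
  let e : V ≃ₗ[ℝ] W := LinearEquiv.ofInjective q hq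
  have he : ∀ (v : V) (z : Circle), ((e v : W) : C(Circle, ℝ)) z = GΛG A B v z :=
    fun v z => rfl
  have he' : ∀ (f : W) (z : Circle), GΛG A B (e.symm f) z = (f : C(Circle, ℝ)) z :=
    fun f z => by rw [← he, LinearEquiv.apply_symm_apply]
  have hcone : ∀ f ∈ positiveCone W, (e.symm f : Matrix (Fin n) (Fin n) ℂ) ∈ LKLΓ A B := by
    intro f hf
    obtain ⟨Φ, hΦ⟩ := (e.symm f).2
    refine ⟨⟨?_, fun z => by rw [he']; exact hf z⟩, Φ, hΦ⟩
    rw [← hΦ]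
    exact isHermitian_Γ A B Φ
  have hcone' : ∀ v : V, (v : Matrix (Fin n) (Fin n) ℂ) ∈ LKLΓ A B → e v ∈ positiveCone W :=
    fun v hv z => hv.1.2 z
  have hsymm : Continuous fun f : W => (e.symm f : Matrix (Fin n) (Fin n) ℂ) :=
    LinearMap.continuous_of_finiteDimensional (V.subtype ∘ₗ e.symm.toLinearMap)
  let ℓ : PΓ A B → W →ₗ[ℝ] ℝ := fun S =>
    { toFun := fun f => ((e.symm f : Matrix (Fin n) (Fin n) ℂ) * S).trace.re
      map_add' := fun f g => by simp [Matrix.add_mul]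
      map_smul' := fun r f => by simp }
  have hℓ : Continuous fun p : PΓ A B × W => ℓ p.1 p.2 :=
    Complex.continuous_re.comp (Continuous.matrix_trace
      ((hsymm.comp continuous_snd).matrix_mul (continuous_subtype_val.comp continuous_fst)))
  have hJ : ∀ (S : PΓ A B) (v : V), (v : Matrix (Fin n) (Fin n) ℂ) ∈ LKLΓ A B →
      SpectrumKL.J A B Ψ S v = logObjective (densityMeasure Ψ) (ℓ S) (e v) := by
    intro S v hv
    have h1 := circleIntegralNormalized_mul hΨ
      ((continuous_GΛG hA B v).log fun z => (hv.1.2 z).ne')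
    simp only [SpectrumKL.J, logObjective, h1, he, ℓ, LinearMap.coe_mk, AddHom.coe_mk,
      LinearEquiv.symm_apply_apply]
  obtain ⟨opt, hopt, hmin⟩ := exists_continuous_minimizer (densityMeasure Ψ) ℓ hℓ
    (hasReciprocalBarrier_densityMeasure hΨ W (by
      rintro _ ⟨v, rfl⟩
      exact contDiff_GΛG_exp hA B v))
    (u := e ⟨Γ A B 1, 1, rfl⟩) (fun z => GΛG_Γ_one_pos hA hB z) (by
      intro S₀
      obtain ⟨c, hc, h⟩ := exists_trace_lower_bound hA hn hAB S₀.2.2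
      refine ⟨c, hc, ?_⟩
      filter_upwards [continuous_subtype_val.continuousAt.eventually h] with S hS f hf
      have h1 := hS S.2.1 _ (hcone f hf).1
      rw [← le_div_iff₀' hc]
      refine (ContinuousMap.norm_le_of_nonempty (f : C(Circle, ℝ))).mpr fun z => ?_
      rw [Real.norm_of_nonneg (hf z).le, le_div_iff₀' hc, ← he']
      exact h1 z)
  refine ⟨fun S => ⟨e.symm (opt S), hcone _ (hmin S).1⟩, fun S Λ hΛ => ?_,
    (hsymm.comp hopt).subtype_mk _⟩
  obtain ⟨v, rfl⟩ : ∃ v : V, (v : Matrix (Fin n) (Fin n) ℂ) = Λ := ⟨⟨Λ, hΛ.2⟩, rfl⟩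
  have h1 := (hmin S).2 (e v) (hcone' v hΛ)
  have h2 : (v : Matrix (Fin n) (Fin n) ℂ) = e.symm (opt S) ↔ e v = opt S := by
    rw [← Subtype.ext_iff, LinearEquiv.eq_symm_apply]
  rw [h2, ← h1]
  constructor
  · intro h f hf
    have h3 := h (hcone f hf)
    simp only [Set.mem_ofPred_eq] at h3 ⊢
    rwa [hJ S v hΛ, hJ S (e.symm f) (hcone f hf), LinearEquiv.apply_symm_apply] at h3
  · rintro h Λ' hΛ'
    obtain ⟨w, rfl⟩ : ∃ w : V, (w : Matrix (Fin n) (Fin n) ℂ) = Λ' := ⟨⟨_, hΛ'.2⟩, rfl⟩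
    have h3 := h (hcone' w hΛ')
    simp only [Set.mem_ofPred_eq] at h3 ⊢
    rwa [hJ S v hΛ, hJ S w hΛ']
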